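/- Let $\Gamma$ be a finite simple graph with vertex set $S$ whose edges $(s,t)$ are labelled by integers $m_{st}\ge 2$ (put $m_{st}=\infty$ if there is no edge). Let $A_\Gamma=\langle S\mid sts\cdots=tst\cdots\ (m_{st}\text{ letters on each side}) \text{ for every edge } (s,t)\rangle$ be the Artin group, and let $A_\Gamma^+$ be the Artin monoid, given by the same presentation as a monoid; identify its elements with their images in $A_\Gamma$. For $T\subseteq S$ such that the Coxeter group $W_T$ is finite, let $\Delta_T\in A_T^+$ be the Garside element, i.e. the element that is both the least common left multiple and the least common right multiple of $T$ in $A_T^+$. Let $\mathcal{M}$ be the set of minimal elements, i.e. of those $m\in A_\Gamma^+$ such that $\Delta_T=mc$ with some $c\in A_\Gamma^+$ for some such $T$. Let $\mathcal{G}=\mathcal{G}(A_\Gamma,\mathcal{M})$ be the Cayley graph of $A_\Gamma$ with respect to $\mathcal{M}$ (edges $v - vm$, each of length $1$), regarded as a metric graph, and let $\mathcal{G}^+=\mathcal{G}^+(A_\Gamma,\mathcal{M})$ be the full subgraph of $\mathcal{G}$ spanned by the vertices in $A_\Gamma^+$. A subspace $Y$ of a metric space $X$ is quasi-convex if there is an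 $N>0$ such that every geodesic of $X$ with endpoints in $Y$ lies in the $N$-neighbourhood of $Y$. Suppose that $S$ contains $s,t,u$ with $s\ne t$ and $m_{su}=m_{tu}=2$ ($m_{st}$ is arbitrary). Then $\mathcal{G}^+$ is not quasi-convex in $\mathcal{G}$. More precisely, for every $n\ge 0$: 1. the path $s^n, s^{n-1},\dots,s,e,t,\dots,t^n$ (of length $2n$) is a geodesic edge path in $\mathcal{G}$ that lies in $\mathcal{G}^+$; 2. the path of length $2n$ from $s^n$ to $t^n$ through $u^{-n}$ with vertices $s^n(su)^{-i}$ $(0\le i\le n)$ followed by $u^{-n}(tu)^i$ $(0\le i\le n)$ is also a geodesic edge path in $\mathcal{G}$; 3. the vertex $u^{-n}$ has distance at least $n$ in $\mathcal{G}$ from every element of $A_\Gamma^+$. In particular, the hypothesis holds for every braid group with at least four standard generators (type $A_n$, $n\ge 4$), so $\mathcal{G}^+$ is not quasi-convex in $\mathcal{G}$ for these groups. -/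

import Mathlib

open scoped ENNReal

/-! ### Artin groups and Artin monoids

A finite simple graph on `S` whose edges carry labels `m_{st} ≥ 2` is the same thing as a Coxeter
matrix `M` on `S`: distinct `s, t` span an edge iff `M s t ≠ 0`, and then `m_{st} = M s t`;
the value `M s t = 0` stands for `m_{st} = ∞` (no edge). -/

namespace CoxeterMatrix

universe u

variable {S : Type u}

/-- The alternating word `s t s ⋯` with `n` letters that starts with `s`. -/
def altWord (s t : S) : ℕ → List S
  | 0 => []
  | n + 1 => s :: altWord t s n

/-- The defining relations of the Artin monoid: for every edge `(s, t)`,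
`s t s ⋯ = t s t ⋯`, both words with `m_{st}` letters. -/
def ArtinRel (M : CoxeterMatrix S) (v w : FreeMonoid S) : Prop :=
  ∃ s t : S, s ≠ t ∧ M s t ≠ 0 ∧
    v = FreeMonoid.ofList (altWord s t (M s t)) ∧ w = FreeMonoid.ofList (altWord t s (M s t))

/-- The Artin monoid `A_Γ⁺`. -/
abbrev ArtinMonoid (M : CoxeterMatrix S) : Type u := PresentedMonoid M.ArtinRel

/-- The standard generators of the Artin monoid. -/
def monoidGen (M : CoxeterMatrix S) (s : S) : M.ArtinMonoid := PresentedMonoid.of M.ArtinRel s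

/-- The relators `v * w⁻¹` of the Artin group, for `v = w` a defining relation. -/
def artinRelators (M : CoxeterMatrix S) : Set (FreeGroup S) :=
  {r | ∃ v w : FreeMonoid S, M.ArtinRel v w ∧
    r = FreeMonoid.lift FreeGroup.of v * (FreeMonoid.lift FreeGroup.of w)⁻¹}

/-- The Artin group `A_Γ`. -/
abbrev ArtinGroup (M : CoxeterMatrix S) : Type u := PresentedGroup M.artinRelators

/-- The standard generators of the Artin group. -/
def groupGen (M : CoxeterMatrix S) (s : S) : M.ArtinGroup := PresentedGroup.of s

theorem lift_groupGen (M : CoxeterMatrix S) (v : FreeMonoid S) :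
    FreeMonoid.lift M.groupGen v =
      PresentedGroup.mk M.artinRelators (FreeMonoid.lift FreeGroup.of v) := by
  induction v using FreeMonoid.inductionOn' with
  | one => simp
  | of_mul x xs ih => simp [ih, groupGen, PresentedGroup.of]

/-- The canonical homomorphism `A_Γ⁺ → A_Γ` that sends generators to generators. -/
def monoidToGroup (M : CoxeterMatrix S) : M.ArtinMonoid →* M.ArtinGroup :=
  PresentedMonoid.lift M.groupGen (by
    intro v w h
    rw [lift_groupGen, lift_groupGen, ← mul_inv_eq_one, ← map_inv, ← map_mul]
    exact PresentedGroup.one_of_mem ⟨v, w, h, rfl⟩)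

/-- The elements of `A_Γ` that lie in (the image of) the Artin monoid `A_Γ⁺`. -/
def positiveElements (M : CoxeterMatrix S) : Submonoid M.ArtinGroup :=
  MonoidHom.mrange M.monoidToGroup

/-- The labelled graph spanned by a set `T` of vertices. -/
def restrict (M : CoxeterMatrix S) (T : Set S) : CoxeterMatrix T where
  M := Matrix.of fun i j => M i j
  isSymm := Matrix.IsSymm.ext fun i j => M.symmetric j i
  diagonal i := M.diagonal i
  off_diagonal i j h := M.off_diagonal i j fun e => h (Subtype.ext e)

theorem map_val_altWord {T : Set S} (s t : T) (n : ℕ) :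
    (altWord s t n).map Subtype.val = altWord (s : S) t n := by
  induction n generalizing s t with
  | zero => rfl
  | succ n ih => simp [altWord, ih]

theorem lift_monoidGen_val (M : CoxeterMatrix S) {T : Set S} (v : FreeMonoid T) :
    FreeMonoid.lift (fun s : T => M.monoidGen s) v =
      PresentedMonoid.mk M.ArtinRel (FreeMonoid.map Subtype.val v) := by
  induction v using FreeMonoid.inductionOn' with
  | one => simp
  | of_mul x xs ih =>
    rw [map_mul, ih, map_mul, map_mul, FreeMonoid.lift_eval_of, FreeMonoid.map_of]
    rfl

/-- The canonical homomorphism `A_T⁺ → A_Γ⁺`. -/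
def specialToMonoid (M : CoxeterMatrix S) (T : Set S) : (M.restrict T).ArtinMonoid →* M.ArtinMonoid :=
  PresentedMonoid.lift (fun s : T => M.monoidGen s) (by
    rintro _ _ ⟨s, t, hst, hm, rfl, rfl⟩
    rw [lift_monoidGen_val, lift_monoidGen_val]
    refine Quotient.sound (ConGen.Rel.of _ _ ⟨s, t, fun e => hst (Subtype.ext e), hm, ?_, ?_⟩)
    · exact congrArg FreeMonoid.ofList (map_val_altWord s t _)
    · exact congrArg FreeMonoid.ofList (map_val_altWord t s _))

/-- `A_Γ` is of finite type if the Coxeter group `W_Γ` is finite. -/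
def IsFiniteType (M : CoxeterMatrix S) : Prop := Finite M.Group

/-- `a ≼_L b`: `b = a c` for some `c` in the monoid. -/
def LeftDivides {A : Type*} [Monoid A] (a b : A) : Prop := ∃ c, b = a * c

/-- `b ≽_R a`: `b = c a` for some `c` in the monoid. -/
def RightDivides {A : Type*} [Monoid A] (a b : A) : Prop := ∃ c, b = c * a

/-- `b = lcm_L X`. -/
def IsLcmL {A : Type*} [Monoid A] (X : Set A) (b : A) : Prop :=
  (∀ x ∈ X, LeftDivides x b) ∧ ∀ c, (∀ x ∈ X, LeftDivides x c) → LeftDivides b c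

/-- `b = lcm_R X`. -/
def IsLcmR {A : Type*} [Monoid A] (X : Set A) (b : A) : Prop :=
  (∀ x ∈ X, RightDivides x b) ∧ ∀ c, (∀ x ∈ X, RightDivides x c) → RightDivides b c

/-- `Δ ∈ A_Γ⁺` is the Garside element: `Δ = lcm_L S = lcm_R S`. -/
def IsGarsideElement (M : CoxeterMatrix S) (Δ : M.ArtinMonoid) : Prop :=
  IsLcmL (Set.range M.monoidGen) Δ ∧ IsLcmR (Set.range M.monoidGen) Δ

/-- The set `ℳ ⊆ A_Γ` of minimal elements: the elements of `A_Γ⁺` that left divide `Δ_T` in `A_Γ⁺`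
for some `T ⊆ S` with `A_T` of finite type. -/
def minimalElements (M : CoxeterMatrix S) : Set M.ArtinGroup :=
  {g | ∃ m : M.ArtinMonoid, M.monoidToGroup m = g ∧
    ∃ T : Set S, (M.restrict T).IsFiniteType ∧
      ∃ Δ : (M.restrict T).ArtinMonoid, (M.restrict T).IsGarsideElement Δ ∧
        LeftDivides m (M.specialToMonoid T Δ)}

/-- The Cayley graph `𝒢(A_Γ, ℳ)`, with an edge between `v` and `v m` for each `m ∈ ℳ`,
`m ≠ 1`. -/
def cayleyGraph (M : CoxeterMatrix S) : SimpleGraph M.ArtinGroup :=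
  SimpleGraph.mulCayley M.minimalElements

end CoxeterMatrix

/-! ### Graphs as metric spaces -/

namespace SimpleGraph

variable {V : Type*}

/-- A walk is geodesic if its length is the distance of its end points. -/
def Walk.IsGeodesic {G : SimpleGraph V} {a b : V} (p : G.Walk a b) : Prop :=
  (p.length : ℕ∞) = G.edist a b

/-- A point of the geometric realization of the graph `G`, in barycentric coordinates: a convex
combination of the two ends of an edge (or a single vertex). -/
structure Realization (G : SimpleGraph V) where
  coord : V →₀ ℝ
  nonneg : ∀ v, 0 ≤ coord v
  sum_eq_one : (coord.sum fun _ r => r) = 1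
  support_subset : ∃ a b, (a = b ∨ G.Adj a b) ∧ (coord.support : Set V) ⊆ {a, b}

namespace Realization

variable {G : SimpleGraph V}

/-- The realization of the full subgraph of `G` spanned by the vertex set `U`. -/
def fullSubgraph (G : SimpleGraph V) (U : Set V) : Set G.Realization :=
  {x | (x.coord.support : Set V) ⊆ U}

/-- The distance from a point `x` to a vertex `v`: the point `x` of an edge with ends `a, b` is
at distance `1 - x_a` from `a`, and the shortest path leaves the edge through one of its ends. -/
noncomputable def vertexDist (x : G.Realization) (v : V) : ℝ≥0∞ :=
  ⨅ a ∈ x.coord.support, ENNReal.ofReal (1 - x.coord a) + (G.edist a v : ℝ≥0∞)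

/-- The distance of `x` and `y` inside a closed edge (of length one) that contains both, and `∞` if
there is no such edge. -/
noncomputable def edgeDist (x y : G.Realization) : ℝ≥0∞ :=
  ⨅ (a : V) (b : V) (_ : (a = b ∨ G.Adj a b) ∧ (x.coord.support : Set V) ⊆ {a, b} ∧
    (y.coord.support : Set V) ⊆ {a, b}), ENNReal.ofReal |x.coord a - y.coord a|

/-- The path metric in which each edge has length one: a shortest path from `x` to `y` either stays
inside an edge or passes through a vertex. -/
noncomputable def pathDist (x y : G.Realization) : ℝ≥0∞ :=
  min (edgeDist x y) (⨅ v, vertexDist x v + vertexDist y v)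

theorem coord_add_coord (x : G.Realization) {a b : V} (hab : a ≠ b)
    (h : (x.coord.support : Set V) ⊆ {a, b}) : x.coord a + x.coord b = 1 := by
  classical
  have h' : x.coord.support ⊆ {a, b} := fun e he => by simpa using h he
  rw [← x.sum_eq_one, Finsupp.sum_of_support_subset _ h' _ (fun _ _ => rfl),
    Finset.sum_pair hab]

theorem coord_eq_one (x : G.Realization) {a : V} (h : (x.coord.support : Set V) ⊆ {a}) :
    x.coord a = 1 := by
  have h' : x.coord.support ⊆ {a} := by exact_mod_cast h
  rw [← x.sum_eq_one, Finsupp.sum_of_support_subset _ h' _ (fun _ _ => rfl),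
    Finset.sum_singleton]

theorem coord_le_one (x : G.Realization) (v : V) : x.coord v ≤ 1 := by
  by_cases hv : v ∈ x.coord.support
  · rw [← x.sum_eq_one]
    exact Finset.single_le_sum (f := fun w => x.coord w) (fun w _ => x.nonneg w) hv
  · rw [Finsupp.notMem_support_iff.1 hv]
    exact zero_le_one

theorem vertexDist_le (x : G.Realization) (v : V) {a : V} (ha : a ∈ x.coord.support) :
    vertexDist x v ≤ ENNReal.ofReal (1 - x.coord a) + (G.edist a v : ℝ≥0∞) :=
  iInf₂_le a ha

theorem edgeDist_comm (x y : G.Realization) : edgeDist x y = edgeDist y x := by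
  unfold edgeDist
  refine iInf_congr fun a => iInf_congr fun b => ?_
  rw [abs_sub_comm]
  exact iInf_congr_Prop (by tauto) fun _ => rfl

theorem pathDist_comm (x y : G.Realization) : pathDist x y = pathDist y x := by
  unfold pathDist
  rw [edgeDist_comm]
  simp_rw [add_comm (vertexDist x _)]

theorem pathDist_self (x : G.Realization) : pathDist x x = 0 := by
  obtain ⟨a, b, h, hs⟩ := x.support_subset
  refine le_antisymm ((min_le_left _ _).trans ?_) zero_le
  refine (iInf₂_le a b).trans ((iInf_le _ ⟨h, hs, hs⟩).trans ?_)
  simp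

theorem edist_triangle' (u v w : V) :
    (G.edist u w : ℝ≥0∞) ≤ (G.edist u v : ℝ≥0∞) + (G.edist v w : ℝ≥0∞) := by
  rw [← ENat.toENNReal_add]
  exact ENat.toENNReal_le.2 G.edist_triangle

theorem abs_coord_sub (x y : G.Realization) {a b : V}
    (hx : (x.coord.support : Set V) ⊆ {a, b}) (hy : (y.coord.support : Set V) ⊆ {a, b}) :
    |x.coord b - y.coord b| = |x.coord a - y.coord a| := by
  rcases eq_or_ne a b with rfl | hab
  · rfl
  · have h1 := coord_add_coord x hab hx
    have h2 := coord_add_coord y hab hy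
    rw [abs_sub_comm, show y.coord b - x.coord b = x.coord a - y.coord a by linarith]

theorem vertexDist_le_edgeDist_add (x y : G.Realization) (v : V) :
    vertexDist x v ≤ edgeDist x y + vertexDist y v := by
  unfold edgeDist
  simp_rw [ENNReal.iInf_add]
  refine le_iInf fun a => le_iInf fun b => le_iInf fun ⟨hab, hx, hy⟩ => ?_
  conv_rhs => unfold vertexDist
  simp_rw [ENNReal.add_iInf]
  refine le_iInf₂ fun c hc => ?_
  have hcab : c = a ∨ c = b := hy hc
  have habs : |x.coord c - y.coord c| = |x.coord a - y.coord a| := by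
    rcases hcab with rfl | rfl
    · rfl
    · exact abs_coord_sub x y hx hy
  rw [← habs, ← add_assoc, ← ENNReal.ofReal_add (abs_nonneg _) (by linarith [y.coord_le_one c])]
  by_cases hcx : c ∈ x.coord.support
  · refine (vertexDist_le x v hcx).trans ?_
    gcongr
    linarith [neg_abs_le (x.coord c - y.coord c)]
  · have hc0 : x.coord c = 0 := Finsupp.notMem_support_iff.1 hcx
    obtain ⟨d, hd⟩ : ∃ d, (x.coord.support : Set V) ⊆ {d} ∧ G.Adj d c := by
      rcases hab with rfl | hab
      · exact absurd (coord_eq_one x (a := a) (by simpa using hx)) (by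
          rcases hcab with rfl | rfl <;> simp [hc0])
      · rcases hcab with rfl | rfl
        · refine ⟨b, fun e he => ?_, hab.symm⟩
          rcases hx he with rfl | h
          · exact absurd he hcx
          · exact h
        · refine ⟨a, fun e he => ?_, hab⟩
          rcases hx he with h | rfl
          · exact h
          · exact absurd he hcx
    have hd1 := coord_eq_one x hd.1
    have hdx : d ∈ x.coord.support := by simp [hd1]
    refine (vertexDist_le x v hdx).trans ?_
    have h1 : (G.edist d v : ℝ≥0∞) ≤ 1 + (G.edist c v : ℝ≥0∞) := by
      have := edist_triangle' (G := G) d c v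
      rwa [edist_eq_one_iff_adj.2 hd.2, ENat.toENNReal_one] at this
    have h2 : |x.coord c - y.coord c| + (1 - y.coord c) = 1 := by
      rw [hc0, zero_sub, abs_neg, abs_of_nonneg (y.nonneg c)]
      ring
    rw [hd1, h2]
    simpa using h1

theorem edist_le_vertexDist_add (x : G.Realization) (v w : V) :
    (G.edist v w : ℝ≥0∞) ≤ vertexDist x v + vertexDist x w := by
  unfold vertexDist
  simp_rw [ENNReal.iInf_add, ENNReal.add_iInf]
  refine le_iInf₂ fun a ha => le_iInf₂ fun c hc => ?_
  have key : (G.edist a c : ℝ≥0∞) ≤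
      ENNReal.ofReal (1 - x.coord a) + ENNReal.ofReal (1 - x.coord c) := by
    rcases eq_or_ne a c with rfl | hac
    · simp
    · obtain ⟨p, q, hpq, hx⟩ := x.support_subset
      have hadj : G.Adj a c ∧ (x.coord.support : Set V) ⊆ {a, c} := by
        have h1 : a = p ∨ a = q := hx ha
        have h2 : c = p ∨ c = q := hx hc
        rcases hpq with rfl | hpq
        · exact absurd (by rw [h1.elim id id, h2.elim id id]) hac
        · rcases h1 with rfl | rfl <;> rcases h2 with rfl | rfl
          · exact absurd rfl hac
          · exact ⟨hpq, hx⟩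
          · exact ⟨hpq.symm, by rwa [Set.pair_comm]⟩
          · exact absurd rfl hac
      have hs := coord_add_coord x hac hadj.2
      rw [edist_eq_one_iff_adj.2 hadj.1, ← ENNReal.ofReal_add (by linarith [x.coord_le_one a])
        (by linarith [x.coord_le_one c]),
        show 1 - x.coord a + (1 - x.coord c) = 1 by linarith]
      simp
  have t1 := edist_triangle' (G := G) v a w
  have t2 := edist_triangle' (G := G) a c w
  rw [G.edist_comm (u := v) (v := a)] at t1
  calc (G.edist v w : ℝ≥0∞)
      ≤ G.edist a v + ((ENNReal.ofReal (1 - x.coord a) + ENNReal.ofReal (1 - x.coord c)) +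
          G.edist c w) := t1.trans (by gcongr; exact t2.trans (by gcongr))
    _ = _ := by ring

theorem pathDist_le_edgeDist_add (x y z : G.Realization) :
    pathDist x z ≤ edgeDist x y + edgeDist y z := by
  by_cases hp : ∃ p, (y.coord.support : Set V) ⊆ {p}
  · obtain ⟨p, hp⟩ := hp
    have hp1 := coord_eq_one y hp
    have h0 : vertexDist y p = 0 := by
      have := vertexDist_le y p (a := p) (by simp [hp1])
      simpa [hp1] using this
    have hx := vertexDist_le_edgeDist_add x y p
    have hz := vertexDist_le_edgeDist_add z y p
    rw [h0, add_zero] at hx hz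
    rw [edgeDist_comm y z]
    exact (min_le_right _ _).trans ((iInf_le _ p).trans (add_le_add hx hz))
  · conv_rhs => unfold edgeDist
    simp_rw [ENNReal.iInf_add, ENNReal.add_iInf]
    refine le_iInf fun a => le_iInf fun b => le_iInf fun ⟨hab, hx, hy⟩ => ?_
    refine le_iInf fun c => le_iInf fun d => le_iInf fun ⟨hcd, hy', hz⟩ => ?_
    push Not at hp
    have hne : a ≠ b := fun e => hp a (by simpa [e] using hy)
    have hmem : a ∈ y.coord.support ∧ b ∈ y.coord.support := by
      constructor
      · by_contra h
        refine hp b fun e he => ?_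
        rcases hy he with rfl | h'
        · exact absurd he h
        · exact h'
      · by_contra h
        refine hp a fun e he => ?_
        rcases hy he with h' | rfl
        · exact h'
        · exact absurd he h
    have ha : a = c ∨ a = d := hy' hmem.1
    have hb : b = c ∨ b = d := hy' hmem.2
    have hset : ({c, d} : Set V) = {a, b} := by
      rcases ha with rfl | rfl <;> rcases hb with rfl | rfl
      · exact absurd rfl hne
      · rfl
      · exact Set.pair_comm _ _
      · exact absurd rfl hne
    rw [hset] at hz hy'
    have habs : |y.coord c - z.coord c| = |y.coord a - z.coord a| := by
      have : c ∈ ({a, b} : Set V) := hset ▸ Set.mem_insert c {d}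
      rcases this with rfl | rfl
      · rfl
      · exact abs_coord_sub y z hy hz
    refine (min_le_left _ _).trans ((iInf₂_le a b).trans ((iInf_le _ ⟨hab, hx, hz⟩).trans ?_))
    rw [habs, ← ENNReal.ofReal_add (abs_nonneg _) (abs_nonneg _)]
    exact ENNReal.ofReal_le_ofReal (abs_sub_le _ _ _)

theorem pathDist_triangle (x y z : G.Realization) :
    pathDist x z ≤ pathDist x y + pathDist y z := by
  have hv : ∀ (x y z : G.Realization),
      pathDist x z ≤ edgeDist x y + ⨅ v, vertexDist y v + vertexDist z v := by
    intro x y z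
    rw [ENNReal.add_iInf]
    refine le_iInf fun v => (min_le_right _ _).trans ((iInf_le _ v).trans ?_)
    rw [← add_assoc]
    gcongr
    exact vertexDist_le_edgeDist_add x y v
  conv_rhs => unfold pathDist
  rcases min_choice (edgeDist x y) (⨅ v, vertexDist x v + vertexDist y v) with h | h <;>
    rcases min_choice (edgeDist y z) (⨅ v, vertexDist y v + vertexDist z v) with h' | h' <;>
    rw [h, h']
  · exact pathDist_le_edgeDist_add x y z
  · exact hv x y z
  · rw [pathDist_comm, add_comm, edgeDist_comm]
    simp_rw [add_comm (vertexDist x _)]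
    exact hv z y x
  · simp_rw [ENNReal.iInf_add, ENNReal.add_iInf]
    refine le_iInf fun v => le_iInf fun w => (min_le_right _ _).trans ((iInf_le _ w).trans ?_)
    have h1 : vertexDist x w ≤ vertexDist x v + (G.edist v w : ℝ≥0∞) := by
      conv_rhs => unfold vertexDist
      simp_rw [ENNReal.iInf_add]
      refine le_iInf₂ fun a ha => (vertexDist_le x w ha).trans ?_
      rw [add_assoc]
      gcongr
      exact edist_triangle' a v w
    calc vertexDist x w + vertexDist z w
        ≤ (vertexDist x v + (vertexDist y v + vertexDist y w)) + vertexDist z w := by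
          gcongr
          exact h1.trans (by gcongr; exact edist_le_vertexDist_add y v w)
      _ = _ := by ring

/-- The realization of a graph with its path metric (points in different components are at
distance `∞`). -/
noncomputable instance : PseudoEMetricSpace G.Realization where
  edist := pathDist
  edist_self := pathDist_self
  edist_comm := pathDist_comm
  edist_triangle := pathDist_triangle

end Realization

end SimpleGraph

/-! ### Quasi-convexity -/

/-- `γ`, restricted to `[0, L]`, is a geodesic (parametrized by arc length). -/
def IsGeodesicPath {X : Type*} [PseudoEMetricSpace X] (γ : ℝ → X) (L : ℝ) : Prop :=
  ∀ r ∈ Set.Icc 0 L, ∀ r' ∈ Set.Icc 0 L, edist (γ r) (γ r') = ENNReal.ofReal |r - r'|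

/-- `Y ⊆ X` is quasi-convex: for some `N > 0`, every geodesic of `X` with end points in `Y` lies in
the `N`-neighbourhood of `Y`. -/
def IsQuasiConvex {X : Type*} [PseudoEMetricSpace X] (Y : Set X) : Prop :=
  ∃ N : ℝ, 0 < N ∧ ∀ (L : ℝ) (γ : ℝ → X), 0 ≤ L → IsGeodesicPath γ L → γ 0 ∈ Y → γ L ∈ Y →
    ∀ r ∈ Set.Icc 0 L, γ r ∈ Metric.thickening N Y

/-- The monoid Cayley graph `𝒢⁺(A_Γ, ℳ)`: the full subgraph of `𝒢(A_Γ, ℳ)` spanned by the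
vertices in `A_Γ⁺`, as a subspace of the metric graph `𝒢(A_Γ, ℳ)`. -/
def CoxeterMatrix.monoidCayleyGraph {S : Type*} (M : CoxeterMatrix S) :
    Set M.cayleyGraph.Realization :=
  SimpleGraph.Realization.fullSubgraph M.cayleyGraph M.positiveElements

/-!
Both geodesics and the distance estimate are certified by functions on `A_Γ` that change by at most
one along every edge of `𝒢`. They come from the reflections of the Coxeter group `W`: an edge
`v - v s` of the Cayley graph of `A_Γ` lies over an edge of the Cayley graph of `W`, which crosses
the wall of the reflection `w s w⁻¹`, where `w` is the image of `v`. The two sides of a defining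
relation cross the same walls, so the signed number of times that `g ∈ A_Γ` crosses the wall of `r`
is well defined. These numbers form the function part of a homomorphism `CoxeterMatrix.crossing`
from `A_Γ` to the semidirect product of `W → ℤ` with `W`.

The main point is `CoxeterMatrix.crossing_minimalElements`: a minimal element crosses every wall
zero times or once. Since crossing numbers are nonnegative on the monoid, it is enough to see that
`Δ_T` divides an element `d ∈ A_T⁺` that crosses no wall twice (a *reduced* element). Such elements
have bounded length because `W_T` is finite. If `d` has maximal length, then it crosses the wall of
every `s ∈ T`, as otherwise `s d` would be a longer reduced element; and a reduced element that
crosses the wall of `s` is divisible by `s` (`CoxeterMatrix.IsReducedPositive.leftDivides`, a form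
of Matsumoto's theorem). Hence `d` is a common multiple of `T` and `Δ_T` divides it. The
divisibility statement splits off the longest alternating word in `s` and another generator `t`. The
remaining factor crosses no wall of the dihedral group of `s, t`
(`CoxeterMatrix.parity_eq_zero_of_mem_parabolic`, a consequence of the exchange property), so the
alternating word itself crosses the wall of `s`. As `s t` has order exactly `m_{st}` in `W`, by the
geometric representation, this word has at least `m_{st}` letters and can be rewritten to start
with `s`.

Let `f_r` be the crossing number of the wall of `r`. Along an edge of `𝒢` all the `f_r` change by
`0` or `1` in a common direction, so `f_u` and `f_t - f_s` change by at most one. The function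
`f_t - f_s` grows with unit speed along both paths from `s^n` to `t^n`, which are therefore
geodesic. The function `f_u` is nonnegative on `A_Γ⁺` and equals `-n` at `u^{-n}`, which gives the
distance from `u^{-n}` to `A_Γ⁺`. The linear extensions of these functions to the geometric
realization are `1`-Lipschitz, so the same two estimates show that the second path is a geodesic of
the metric graph whose midpoint is far from `𝒢⁺`.
-/

/-! ### The semidirect product of functions on a group with the group -/

/-- The semidirect product of the additive group of functions `W → R` with `W`, which acts on
functions through conjugation of the argument. -/
@[ext]
structure ConjSemidirect (W R : Type*) where
  val : W → R
  el : W

namespace ConjSemidirect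

variable {W R R' : Type*} [Group W] [AddCommGroup R] [AddCommGroup R']

instance : Mul (ConjSemidirect W R) :=
  ⟨fun a b => ⟨fun r => a.val r + b.val (a.el⁻¹ * r * a.el), a.el * b.el⟩⟩

instance : One (ConjSemidirect W R) := ⟨⟨fun _ => 0, 1⟩⟩

instance : Inv (ConjSemidirect W R) := ⟨fun a => ⟨fun r => -a.val (a.el * r * a.el⁻¹), a.el⁻¹⟩⟩

@[simp] theorem mul_val (a b : ConjSemidirect W R) (r : W) :
    (a * b).val r = a.val r + b.val (a.el⁻¹ * r * a.el) := rfl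

@[simp] theorem mul_el (a b : ConjSemidirect W R) : (a * b).el = a.el * b.el := rfl

@[simp] theorem one_val (r : W) : (1 : ConjSemidirect W R).val r = 0 := rfl

@[simp] theorem one_el : (1 : ConjSemidirect W R).el = 1 := rfl

@[simp] theorem inv_val (a : ConjSemidirect W R) (r : W) :
    a⁻¹.val r = -a.val (a.el * r * a.el⁻¹) := rfl

@[simp] theorem inv_el (a : ConjSemidirect W R) : a⁻¹.el = a.el⁻¹ := rfl

instance : Group (ConjSemidirect W R) :=
  Group.ofLeftAxioms
    (by intro a b c; ext <;> simp [mul_assoc, add_assoc])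
    (by intro a; ext <;> simp)
    (by intro a; ext <;> simp [mul_assoc])

/-- The projection onto the group. -/
def elHom : ConjSemidirect W R →* W where
  toFun := el
  map_one' := rfl
  map_mul' _ _ := rfl

/-- The change of coefficients. -/
def mapCoeff (f : R →+ R') : ConjSemidirect W R →* ConjSemidirect W R' where
  toFun a := ⟨fun r => f (a.val r), a.el⟩
  map_one' := by ext <;> simp
  map_mul' a b := by ext <;> simp

end ConjSemidirect

namespace CoxeterMatrix

universe u

variable {S : Type u} (M : CoxeterMatrix S)

/-! ### Alternating words -/

theorem length_altWord (s t : S) (n : ℕ) : (altWord s t n).length = n := by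
  induction n generalizing s t with
  | zero => rfl
  | succ n ih => simp [altWord, ih]

theorem altWord_prefix_add (s t : S) (a b : ℕ) : altWord s t a <+: altWord s t (a + b) := by
  induction a generalizing s t with
  | zero => simp [altWord]
  | succ a ih =>
    rw [Nat.succ_add]
    simpa [altWord] using ih t s

/-- The last letter of an alternating word and the letter that continues it are the two letters of
the alphabet, in one of the two orders. -/
theorem exists_altWord_succ (s t : S) (k : ℕ) :
    ∃ (x y : S) (l : List S), (x = s ∧ y = t ∨ x = t ∧ y = s) ∧
      altWord s t (k + 1) = l ++ [y] ∧ altWord s t (k + 2) = l ++ [y, x] := by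
  induction k generalizing s t with
  | zero => exact ⟨t, s, [], by simp, rfl, rfl⟩
  | succ k ih =>
    obtain ⟨x, y, l, h, h1, h2⟩ := ih t s
    refine ⟨x, y, s :: l, h.symm, ?_, ?_⟩
    · rw [altWord, h1]; rfl
    · rw [altWord, h2]; rfl

theorem prod_map_altWord_of_involutive {G : Type*} [Group G] (f : S → G)
    (hf : ∀ s, f s * f s = 1) (s t : S) (n : ℕ) :
    ((altWord s t n).map f).prod = (f s * f t) ^ n * ((altWord t s n).map f).prod := by
  induction n generalizing s t with
  | zero => simp [altWord]
  | succ n ih =>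
    have h : f s * (f t * f s) ^ n = (f s * f t) ^ n * f s := by
      rw [(SemiconjBy.pow_right (x := f t * f s) (y := f s * f t) (a := f s)
        (by simp [SemiconjBy, mul_assoc]) n).eq]
    simp only [altWord, List.map_cons, List.prod_cons]
    rw [ih t s, ← mul_assoc, h, pow_succ]
    simp only [mul_assoc]
    rw [← mul_assoc (f t) (f t), hf, one_mul]

/-! ### Counting the walls crossed by a word -/

theorem simple_mul_self (s : S) : M.simple s * M.simple s = 1 :=
  M.toCoxeterSystem.simple_mul_simple_self s

theorem simple_inv (s : S) : (M.simple s)⁻¹ = M.simple s :=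
  M.toCoxeterSystem.inv_simple s

theorem simple_mul_simple_pow (s t : S) : (M.simple s * M.simple t) ^ M s t = 1 :=
  M.toCoxeterSystem.simple_mul_simple_pow s t

open Classical in
/-- The generator `s` together with the indicator function of its wall, which is encoded by the
reflection `s`. -/
noncomputable def wallGen (R : Type*) [CommRing R] (s : S) : ConjSemidirect M.Group R :=
  ⟨fun r => if r = M.simple s then 1 else 0, M.simple s⟩

section

variable (R : Type*) [CommRing R]

@[simp] theorem wallGen_el (s : S) : (M.wallGen R s).el = M.simple s := rfl

open Classical in
theorem wallGen_val (s : S) (r : M.Group) :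
    (M.wallGen R s).val r = if r = M.simple s then 1 else 0 := rfl

theorem el_prod_wallGen (l : List S) :
    (l.map (M.wallGen R)).prod.el = (l.map M.simple).prod := by
  induction l with
  | nil => rfl
  | cons a l ih => simp [ih]

open Classical in
/-- The walls crossed by an alternating word belong to the reflections `(st)^i s`. -/
theorem val_prod_altWord (s t : S) (n : ℕ) (r : M.Group) :
    ((altWord s t n).map (M.wallGen R)).prod.val r =
      ∑ i ∈ Finset.range n, if r = (M.simple s * M.simple t) ^ i * M.simple s then 1 else 0 := by
  induction n generalizing s t r with
  | zero => simp [altWord]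
  | succ n ih =>
    simp only [altWord, List.map_cons, List.prod_cons, ConjSemidirect.mul_val, wallGen_el, ih,
      wallGen_val, Finset.sum_range_succ', pow_zero, one_mul]
    rw [add_comm]
    congr 1
    refine Finset.sum_congr rfl fun i _ => if_congr ?_ rfl rfl
    have h : M.simple s * ((M.simple t * M.simple s) ^ i * M.simple t) * M.simple s =
        (M.simple s * M.simple t) ^ (i + 1) * M.simple s := by
      have := (SemiconjBy.pow_right (x := M.simple t * M.simple s)
        (y := M.simple s * M.simple t) (a := M.simple s)
        (by simp [SemiconjBy, mul_assoc]) i).eq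
      rw [← mul_assoc, this, pow_succ]
      simp only [mul_assoc]
    rw [← h, mul_assoc, inv_mul_eq_iff_eq_mul, ← eq_mul_inv_iff_mul_eq, simple_inv]

/-- The two sides of a defining relation cross the same walls: `(st)^i s = (ts)^j t` when
`i + j + 1 = m_{st}`. -/
theorem prod_altWord_wallGen (s t : S) :
    ((altWord s t (M s t)).map (M.wallGen R)).prod =
      ((altWord t s (M s t)).map (M.wallGen R)).prod := by
  classical
  have hpow := M.simple_mul_simple_pow s t
  ext r
  · rw [val_prod_altWord, val_prod_altWord, ← Finset.sum_range_reflect]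
    refine Finset.sum_congr rfl fun i hi => if_congr ?_ rfl rfl
    have hi : i < M s t := Finset.mem_range.1 hi
    have h : (M.simple s * M.simple t) ^ (M s t - 1 - i) * M.simple s =
        (M.simple t * M.simple s) ^ i * M.simple t := by
      have h1 : (M.simple t * M.simple s) = (M.simple s * M.simple t)⁻¹ := by
        simp [simple_inv]
      rw [h1, inv_pow, eq_inv_mul_iff_mul_eq, ← mul_assoc, ← pow_add,
        ← mul_left_inj (M.simple t), simple_mul_self, mul_assoc, ← pow_succ,
        show i + (M s t - 1 - i) + 1 = M s t by omega, hpow]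
    rw [h]
  · rw [el_prod_wallGen, el_prod_wallGen, prod_map_altWord_of_involutive _ M.simple_mul_self,
      hpow, one_mul]

end

/-- The number of times, counted with sign, that an element of the Artin group crosses each wall
of the Coxeter group, together with its image in the Coxeter group. -/
noncomputable def crossing : M.ArtinGroup →* ConjSemidirect M.Group ℤ :=
  PresentedGroup.toGroup (f := M.wallGen ℤ) (by
    have key (v : FreeMonoid S) : FreeGroup.lift (M.wallGen ℤ) (FreeMonoid.lift FreeGroup.of v) =
        FreeMonoid.lift (M.wallGen ℤ) v := by
      induction v using FreeMonoid.inductionOn' with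
      | one => simp
      | of_mul x xs ih => simp [ih]
    rintro _ ⟨_, _, ⟨s, t, -, -, rfl, rfl⟩, rfl⟩
    rw [map_mul, map_inv, key, key, mul_inv_eq_one, FreeMonoid.lift_ofList, FreeMonoid.lift_ofList]
    exact M.prod_altWord_wallGen ℤ s t)

@[simp] theorem crossing_groupGen (s : S) : M.crossing (M.groupGen s) = M.wallGen ℤ s :=
  PresentedGroup.toGroup.of _

/-- The set of walls that separate `1` from `w`, as a function with values in `ZMod 2`. -/
noncomputable def parity : M.Group →* ConjSemidirect M.Group (ZMod 2) :=
  M.toCoxeterSystem.lift ⟨M.wallGen (ZMod 2), by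
    intro s t
    have hinv (s : S) : M.wallGen (ZMod 2) s * M.wallGen (ZMod 2) s = 1 := by
      ext r
      · have h : (M.simple s)⁻¹ * r * M.simple s = M.simple s ↔ r = M.simple s := by
          rw [mul_assoc, inv_mul_eq_iff_eq_mul, mul_left_inj]
        rw [ConjSemidirect.mul_val, wallGen_val, wallGen_val, wallGen_el, ConjSemidirect.one_val]
        by_cases hr : r = M.simple s
        · rw [if_pos hr, if_pos (h.2 hr)]
          decide
        · rw [if_neg hr, if_neg (mt h.1 hr), add_zero]
      · exact M.simple_mul_self s
    have h := M.prod_altWord_wallGen (ZMod 2) s t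
    rw [prod_map_altWord_of_involutive _ hinv] at h
    simpa using h⟩

@[simp] theorem parity_simple (s : S) : M.parity (M.simple s) = M.wallGen (ZMod 2) s :=
  M.toCoxeterSystem.lift_apply_simple _ s

@[simp] theorem parity_el (w : M.Group) : (M.parity w).el = w :=
  DFunLike.congr_fun (M.toCoxeterSystem.ext_simple
    (φ₁ := ConjSemidirect.elHom.comp M.parity) (φ₂ := MonoidHom.id _)
    fun s => by simp [ConjSemidirect.elHom]) w

/-- The signed number of crossings determines modulo two which walls separate `1` from the image in
the Coxeter group. -/
theorem parity_crossing (g : M.ArtinGroup) (r : M.Group) :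
    (M.parity (M.crossing g).el).val r = ((M.crossing g).val r : ZMod 2) := by
  have h : M.parity.comp (ConjSemidirect.elHom.comp M.crossing) =
      (ConjSemidirect.mapCoeff (Int.castAddHom (ZMod 2))).comp M.crossing := by
    refine PresentedGroup.ext fun s => ?_
    have hs : M.crossing (PresentedGroup.of s) = M.wallGen ℤ s := M.crossing_groupGen s
    ext r
    · simp [hs, ConjSemidirect.elHom, ConjSemidirect.mapCoeff, wallGen_val]
    · simp [hs, ConjSemidirect.elHom, ConjSemidirect.mapCoeff]
  exact congrFun (congrArg ConjSemidirect.val (DFunLike.congr_fun h g)) r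

/-! ### Exchange and parabolic subgroups -/

/-- The exchange property: a wall that separates `1` from a product of generators is crossed by one
of the letters, which can be deleted. -/
theorem exists_sublist_of_parity_ne_zero (l : List S) (r : M.Group)
    (h : (M.parity (l.map M.simple).prod).val r ≠ 0) :
    ∃ l' : List S, l'.Sublist l ∧ l'.length < l.length ∧
      r * (l.map M.simple).prod = (l'.map M.simple).prod := by
  induction l generalizing r with
  | nil => simp at h
  | cons a l ih =>
    simp only [List.map_cons, List.prod_cons, map_mul, parity_simple, ConjSemidirect.mul_val,
      wallGen_el, wallGen_val] at h
    by_cases hr : r = M.simple a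
    · refine ⟨l, List.sublist_cons_self a l, by simp, ?_⟩
      simp [hr, ← mul_assoc, simple_mul_self]
    · rw [if_neg hr, zero_add] at h
      obtain ⟨l', h1, h2, h3⟩ := ih _ h
      refine ⟨a :: l', h1.cons_cons a, by simpa using h2, ?_⟩
      simp only [List.map_cons, List.prod_cons, ← h3]
      simp [mul_assoc]

/-- The subgroup of the Coxeter group that is generated by the set `T` of generators. -/
def parabolic (T : Set S) : Subgroup M.Group where
  carrier := {w | ∃ l : List S, (∀ a ∈ l, a ∈ T) ∧ (l.map M.simple).prod = w}
  mul_mem' := by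
    rintro _ _ ⟨l, hl, rfl⟩ ⟨l', hl', rfl⟩
    exact ⟨l ++ l', by simpa [or_imp, forall_and] using ⟨hl, hl'⟩, by simp⟩
  one_mem' := ⟨[], by simp, by simp⟩
  inv_mem' := by
    rintro _ ⟨l, hl, rfl⟩
    refine ⟨l.reverse, by simpa using hl, ?_⟩
    rw [List.prod_inv_reverse, List.map_map, List.map_reverse]
    congr 3
    ext s
    simp [simple_inv]

theorem simple_mem_parabolic {T : Set S} {s : S} (hs : s ∈ T) : M.simple s ∈ M.parabolic T :=
  ⟨[s], by simpa using hs, by simp⟩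

/-- If no wall of a generator in `T` separates `1` from `w`, then no wall of `W_T` does. -/
theorem parity_eq_zero_of_mem_parabolic {T : Set S} {w : M.Group}
    (h : ∀ a ∈ T, (M.parity w).val (M.simple a) = 0) {r : M.Group} (hr : r ∈ M.parabolic T) :
    (M.parity w).val r = 0 := by
  classical
  -- `w = p * b` with `p ∈ W_T`, where `b` has a word of least length
  have hex : ∃ n, ∃ p ∈ M.parabolic T, ∃ l : List S, l.length = n ∧
      w = p * (l.map M.simple).prod := by
    obtain ⟨l, hl⟩ := M.toCoxeterSystem.wordProd_surjective w
    exact ⟨_, 1, one_mem _, l, rfl, by rw [one_mul]; exact hl.symm⟩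
  obtain ⟨p, hp, b, hb, hw⟩ := Nat.find_spec hex
  have hb0 : ∀ r ∈ M.parabolic T, (M.parity (b.map M.simple).prod).val r = 0 := by
    intro r hr
    by_contra hne
    obtain ⟨b', -, hlt, he⟩ := M.exists_sublist_of_parity_ne_zero b r hne
    refine Nat.find_min hex (m := b'.length) (by omega)
      ⟨p * r⁻¹, mul_mem hp (inv_mem hr), b', rfl, ?_⟩
    rw [← he, hw]
    simp [mul_assoc]
  have hval : ∀ r ∈ M.parabolic T, (M.parity w).val r = (M.parity p).val r := by
    intro r hr
    rw [hw, map_mul, ConjSemidirect.mul_val, parity_el,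
      hb0 _ (mul_mem (mul_mem (inv_mem hp) hr) hp), add_zero]
  -- a shortest word of `p` in `T` has no first letter
  have hex' : ∃ n, ∃ l : List S, l.length = n ∧ (∀ a ∈ l, a ∈ T) ∧ (l.map M.simple).prod = p := by
    obtain ⟨l, hl⟩ := hp
    exact ⟨_, l, rfl, hl⟩
  obtain ⟨l, hl, hlT, hlp⟩ := Nat.find_spec hex'
  have hp1 : p = 1 := by
    rcases l with _ | ⟨a, l⟩
    · simpa using hlp.symm
    · exfalso
      have haT : a ∈ T := hlT a (by simp)
      have h0 := hval _ (M.simple_mem_parabolic haT)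
      rw [h a haT, ← hlp] at h0
      simp only [List.map_cons, List.prod_cons, map_mul, parity_simple, ConjSemidirect.mul_val,
        wallGen_el, wallGen_val, if_true, simple_inv, simple_mul_self, one_mul] at h0
      obtain ⟨l', hsub, hlt, he⟩ := M.exists_sublist_of_parity_ne_zero l (M.simple a) (by
        intro h1
        rw [h1] at h0
        exact absurd h0 (by decide))
      refine Nat.find_min hex' (m := l'.length) (by simp at hl; omega)
        ⟨l', rfl, fun b hb => hlT b (List.mem_cons_of_mem _ (hsub.subset hb)), ?_⟩
      rw [← he, ← hlp]
      simp
  rw [hval r hr, hp1]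
  simp

/-! ### The geometric representation -/

open Polynomial Polynomial.Chebyshev in
/-- Two reflections whose mirrors meet at the angle `π / m` satisfy the dihedral relation; the
coefficients of the powers of their product are Chebyshev polynomials of the trace
`2 cos (2π / m)`. -/
theorem reflection_mul_reflection_pow_eq_one {V : Type*} [AddCommGroup V] [Module ℝ V] {x y : V}
    {f g : Module.Dual ℝ V} (hf : f x = 2) (hg : g y = 2) {m : ℕ} (hm : 2 ≤ m)
    (hfy : f y = -2 * Real.cos (Real.pi / m)) (hgx : g x = -2 * Real.cos (Real.pi / m)) :
    (Module.reflection hf * Module.reflection hg) ^ m = 1 := by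
  have hm0 : (m : ℝ) ≠ 0 := by positivity
  rcases hm.eq_or_lt with rfl | hm3
  · have h0 : f y = 0 ∧ g x = 0 := by simp [hfy, hgx]
    ext z
    rw [pow_two]
    change Module.reflection hf (Module.reflection hg
      (Module.reflection hf (Module.reflection hg z))) = z
    simp only [Module.reflection_apply, map_sub, map_smul, h0.1, h0.2, hf, hg]
    module
  set φ : ℝ := 2 * (Real.pi / m) with hφ
  have ht : 2 * Real.cos φ = f y * g x - 2 := by
    rw [hfy, hgx, hφ, Real.cos_two_mul]
    ring
  have hmφ : (m : ℝ) * φ = 2 * Real.pi := by rw [hφ]; field_simp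
  have hsin : Real.sin φ ≠ 0 := by
    refine (Real.sin_pos_of_pos_of_lt_pi (by positivity) ?_).ne'
    have h3 : (3 : ℝ) ≤ m := by exact_mod_cast hm3
    nlinarith [Real.pi_pos]
  have hS (k : ℤ) : (S ℝ k).eval (2 * Real.cos φ) * Real.sin φ = Real.sin ((k + 1) * φ) :=
    S_two_mul_real_cos φ k
  -- both coefficients in the formula for the power contain a vanishing factor
  have hc : (S ℝ (((m : ℤ) - 2) / 2)).eval (2 * Real.cos φ) *
        ((S ℝ (((m : ℤ) - 1) / 2)).eval (2 * Real.cos φ) +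
          (S ℝ (((m : ℤ) - 3) / 2)).eval (2 * Real.cos φ)) = 0 ∧
      (S ℝ (((m : ℤ) - 1) / 2)).eval (2 * Real.cos φ) *
        ((S ℝ ((m : ℤ) / 2)).eval (2 * Real.cos φ) +
          (S ℝ (((m : ℤ) - 2) / 2)).eval (2 * Real.cos φ)) = 0 := by
    rcases Nat.even_or_odd' m with ⟨j, hj | hj⟩
    · have h1 : ((m : ℤ) - 2) / 2 = (j : ℤ) - 1 := by omega
      have h2 : ((m : ℤ) - 1) / 2 = (j : ℤ) - 1 := by omega
      have h0 : (S ℝ ((j : ℤ) - 1)).eval (2 * Real.cos φ) = 0 := by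
        have := hS ((j : ℤ) - 1)
        have hj' : (m : ℝ) = 2 * j := by exact_mod_cast hj
        rw [show (((j : ℤ) - 1 : ℤ) + 1 : ℝ) * φ = Real.pi by push_cast; rw [hj'] at hmφ; linarith,
          Real.sin_pi] at this
        exact (mul_eq_zero.1 this).resolve_right hsin
      rw [h1, h2, h0, zero_mul, zero_mul]
      exact ⟨rfl, rfl⟩
    · have h1 : ((m : ℤ) - 2) / 2 = (j : ℤ) - 1 := by omega
      have h2 : ((m : ℤ) - 1) / 2 = (j : ℤ) := by omega
      have h3 : ((m : ℤ) - 3) / 2 = (j : ℤ) - 1 := by omega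
      have h4 : (m : ℤ) / 2 = (j : ℤ) := by omega
      have h0 : (S ℝ (j : ℤ)).eval (2 * Real.cos φ) +
          (S ℝ ((j : ℤ) - 1)).eval (2 * Real.cos φ) = 0 := by
        have e1 := hS j
        have e2 := hS ((j : ℤ) - 1)
        have hj' : (m : ℝ) = 2 * j + 1 := by exact_mod_cast hj
        rw [show (((j : ℤ) : ℝ) + 1) * φ = 2 * Real.pi - j * φ by
          push_cast; rw [hj'] at hmφ; linarith, Real.sin_two_pi_sub] at e1
        rw [show (((j : ℤ) - 1 : ℤ) + 1 : ℝ) * φ = j * φ by push_cast; ring] at e2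
        have : ((S ℝ (j : ℤ)).eval (2 * Real.cos φ) +
          (S ℝ ((j : ℤ) - 1)).eval (2 * Real.cos φ)) * Real.sin φ = 0 := by
          rw [add_mul, e1, e2]; ring
        exact (mul_eq_zero.1 this).resolve_right hsin
      rw [h1, h2, h3, h4, h0, mul_zero, mul_zero]
      exact ⟨rfl, rfl⟩
  ext z
  rw [Module.reflection_mul_reflection_pow_apply hf hg m z (2 * Real.cos φ) ht, hc.1, hc.2]
  simp

/-- The linear form that defines the reflection of the generator `s` in the geometric
representation; for `m_{st} = ∞`, encoded by `M s t = 0`, the junk value `π / 0 = 0` gives the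
usual `-2`. -/
noncomputable def coroot (s : S) : Module.Dual ℝ (S →₀ ℝ) :=
  Finsupp.linearCombination ℝ fun t => -2 * Real.cos (Real.pi / M s t)

theorem coroot_single (s t : S) :
    M.coroot s (Finsupp.single t 1) = -2 * Real.cos (Real.pi / M s t) := by
  simp [coroot]

theorem coroot_single_self (s : S) : M.coroot s (Finsupp.single s 1) = 2 := by
  simp [coroot_single]

/-- The geometric representation of the Coxeter group. -/
noncomputable def geomRep : M.Group →* ((S →₀ ℝ) ≃ₗ[ℝ] (S →₀ ℝ)) :=
  M.toCoxeterSystem.lift ⟨fun s => Module.reflection (M.coroot_single_self s), by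
    intro s t
    rcases eq_or_ne s t with rfl | hst
    · rw [M.diagonal, pow_one]
      ext1 z
      exact Module.involutive_reflection (M.coroot_single_self s) z
    rcases eq_or_ne (M s t) 0 with h | h
    · rw [h, pow_zero]
    · have h1 := M.off_diagonal s t hst
      refine reflection_mul_reflection_pow_eq_one _ _ (by omega) (M.coroot_single s t) ?_
      rw [coroot_single, M.symmetric t s]⟩

theorem geomRep_simple (s : S) :
    M.geomRep (M.simple s) = Module.reflection (M.coroot_single_self s) :=
  M.toCoxeterSystem.lift_apply_simple _ s

open Polynomial Polynomial.Chebyshev in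
/-- The product of two distinct generators of the Coxeter group has order at least `m_{st}`, because
this is its order in the geometric representation. -/
theorem le_of_simple_mul_simple_pow_eq_one {s t : S} (hst : s ≠ t) {k : ℕ} (hk : k ≠ 0)
    (h : (M.simple s * M.simple t) ^ k = 1) : M s t ≠ 0 ∧ M s t ≤ k := by
  have h1 := M.off_diagonal s t hst
  by_contra hcon
  have hcon' : M s t = 0 ∨ k < M s t := by
    by_contra hn
    push Not at hn
    exact hcon hn
  have hx := congrArg (fun w => M.geomRep w (Finsupp.single s 1)) h
  simp only [map_pow, map_mul, geomRep_simple, map_one, LinearEquiv.coe_one, id] at hx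
  rw [Module.reflection_mul_reflection_pow_apply_self, coroot_single, coroot_single,
    M.symmetric t s] at hx
  have hs := DFunLike.congr_fun hx s
  have ht := DFunLike.congr_fun hx t
  simp only [Finsupp.coe_add, Finsupp.coe_smul, Pi.add_apply, Pi.smul_apply, smul_eq_mul,
    Finsupp.single_eq_same, Finsupp.single_eq_of_ne hst, Finsupp.single_eq_of_ne hst.symm, mul_one,
    mul_zero, add_zero, zero_add] at hs ht
  rcases eq_or_ne (M s t) 0 with h0 | h0
  · have h2 : -2 * Real.cos (Real.pi / (0 : ℕ)) * (-2 * Real.cos (Real.pi / (0 : ℕ))) - 2 = 2 := by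
      norm_num
    rw [h0, h2, S_eval_two] at ht
    simp [hk] at ht
  have hkm : k < M s t := hcon'.resolve_left h0
  generalize hm : M s t = m at *
  have hmpos : (0 : ℝ) < m := by exact_mod_cast Nat.pos_of_ne_zero h0
  set θ : ℝ := Real.pi / m with hθ
  have hmθ : m * θ = Real.pi := by rw [hθ]; field_simp
  have hθpos : 0 < θ := by positivity
  have htr : -2 * Real.cos θ * (-2 * Real.cos θ) - 2 = 2 * Real.cos (2 * θ) := by
    rw [Real.cos_two_mul]
    ring
  rw [htr] at hs ht
  by_cases hm2 : m = 2
  · have hk1 : k = 1 := by omega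
    subst hk1
    have : 2 * θ = Real.pi := by rw [← hmθ, hm2]; norm_num
    rw [this] at hs
    norm_num at hs
  have hm3 : (3 : ℝ) ≤ m := by
    have : 3 ≤ m := by omega
    exact_mod_cast this
  have hθ3 : 3 * θ ≤ Real.pi := by nlinarith
  have hcos : Real.cos θ ≠ 0 :=
    (Real.cos_pos_of_mem_Ioo ⟨by linarith, by linarith⟩).ne'
  have hsin : Real.sin (2 * θ) ≠ 0 :=
    (Real.sin_pos_of_pos_of_lt_pi (by positivity) (by linarith)).ne'
  have h0' : (Chebyshev.S ℝ ((k : ℤ) - 1)).eval (2 * Real.cos (2 * θ)) = 0 := by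
    rcases mul_eq_zero.1 ht with h | h
    · exact h
    · exact absurd h (by simpa using hcos)
  have e1 := S_two_mul_real_cos (2 * θ) ((k : ℤ) - 1)
  have e2 := S_two_mul_real_cos (2 * θ) (k : ℤ)
  rw [h0', add_zero] at hs
  rw [h0', zero_mul] at e1
  rw [hs, one_mul] at e2
  rw [show (((k : ℤ) - 1 : ℤ) + 1 : ℝ) * (2 * θ) = k * (2 * θ) by push_cast; ring] at e1
  rw [show (((k : ℤ) : ℝ) + 1) * (2 * θ) = k * (2 * θ) + 2 * θ by push_cast; ring,
    Real.sin_add, ← e1, zero_mul, zero_add] at e2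
  have e3 : Real.cos (k * (2 * θ)) = 1 := by
    have : (Real.cos (k * (2 * θ)) - 1) * Real.sin (2 * θ) = 0 := by linarith
    linarith [(mul_eq_zero.1 this).resolve_right hsin]
  -- `0 < 2 k π / m < 2 π` is not a multiple of `2 π`
  have hkpos : (0 : ℝ) < k := by exact_mod_cast Nat.pos_of_ne_zero hk
  have hkm' : (k : ℝ) < m := by exact_mod_cast hkm
  have e4 := (Real.cos_eq_one_iff_of_lt_of_lt (x := k * (2 * θ)) (by
    have : 0 < k * (2 * θ) := by positivity
    linarith [Real.pi_pos]) (by nlinarith)).1 e3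
  have : 0 < k * (2 * θ) := by positivity
  linarith

/-! ### Positive elements -/

theorem artinMonoid_cases (d : M.ArtinMonoid) : d = 1 ∨ ∃ s d', d = M.monoidGen s * d' := by
  obtain ⟨w, rfl⟩ := PresentedMonoid.surjective_mk d
  cases w using FreeMonoid.casesOn with
  | one => exact Or.inl (map_one _)
  | of_mul s w => exact Or.inr ⟨s, PresentedMonoid.mk _ w, map_mul _ _ _⟩

theorem artinMonoid_induction {p : M.ArtinMonoid → Prop} (one : p 1)
    (gen_mul : ∀ s d, p d → p (M.monoidGen s * d)) (d : M.ArtinMonoid) : p d := by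
  obtain ⟨w, rfl⟩ := PresentedMonoid.surjective_mk d
  induction w using FreeMonoid.inductionOn' with
  | one => rwa [map_one]
  | of_mul s w ih => rw [map_mul]; exact gen_mul s _ ih

theorem prod_altWord_monoidGen {s t : S} (hst : s ≠ t) (hm : M s t ≠ 0) :
    ((altWord s t (M s t)).map M.monoidGen).prod =
      ((altWord t s (M s t)).map M.monoidGen).prod := by
  have key (l : List S) : (l.map M.monoidGen).prod =
      PresentedMonoid.mk M.ArtinRel (FreeMonoid.ofList l) := by
    induction l with
    | nil => simp
    | cons a l ih => rw [List.map_cons, List.prod_cons, ih, FreeMonoid.ofList_cons, map_mul]; rfl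
  rw [key, key]
  exact PresentedMonoid.mk_eq_mk_of_rel ⟨s, t, hst, hm, rfl, rfl⟩

/-- The length homomorphism; the defining relations preserve the number of letters. -/
def wordLengthHom : M.ArtinMonoid →* Multiplicative ℕ :=
  PresentedMonoid.lift (fun _ => Multiplicative.ofAdd 1) (by
    rintro _ _ ⟨s, t, -, -, rfl, rfl⟩
    simp [FreeMonoid.lift_ofList, length_altWord])

/-- The number of letters of the words that represent an element of the Artin monoid. -/
def wordLength (d : M.ArtinMonoid) : ℕ := (M.wordLengthHom d).toAdd

@[simp] theorem wordLength_one : M.wordLength 1 = 0 := rfl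

@[simp] theorem wordLength_mul (a b : M.ArtinMonoid) :
    M.wordLength (a * b) = M.wordLength a + M.wordLength b := by
  simp [wordLength]

@[simp] theorem wordLength_monoidGen (s : S) : M.wordLength (M.monoidGen s) = 1 := rfl

theorem wordLength_prod_map (l : List S) : M.wordLength (l.map M.monoidGen).prod = l.length := by
  induction l with
  | nil => rfl
  | cons a l ih => simp [ih, add_comm]

@[simp] theorem monoidToGroup_monoidGen (s : S) : M.monoidToGroup (M.monoidGen s) = M.groupGen s :=
  rfl

theorem crossing_nonneg (d : M.ArtinMonoid) (r : M.Group) :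
    0 ≤ (M.crossing (M.monoidToGroup d)).val r := by
  classical
  induction d using M.artinMonoid_induction generalizing r with
  | one => simp
  | gen_mul s d ih =>
    rw [map_mul, map_mul, ConjSemidirect.mul_val]
    refine add_nonneg ?_ (ih _)
    rw [monoidToGroup_monoidGen, crossing_groupGen, wallGen_val]
    split_ifs <;> simp

/-! ### Reduced elements of the Artin monoid of a subset of the generators -/

/-- The crossings, in the whole Coxeter group, of an element of the Artin monoid of `T`. -/
noncomputable def specialCrossing (T : Set S) :
    (M.restrict T).ArtinMonoid →* ConjSemidirect M.Group ℤ :=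
  M.crossing.comp (M.monoidToGroup.comp (M.specialToMonoid T))

variable {T : Set S}

@[simp] theorem specialCrossing_monoidGen (s : T) :
    M.specialCrossing T ((M.restrict T).monoidGen s) = M.wallGen ℤ s :=
  M.crossing_groupGen _

theorem specialCrossing_nonneg (d : (M.restrict T).ArtinMonoid) (r : M.Group) :
    0 ≤ (M.specialCrossing T d).val r := M.crossing_nonneg _ r

theorem specialCrossing_prod_map (l : List T) :
    M.specialCrossing T (l.map (M.restrict T).monoidGen).prod =
      ((l.map Subtype.val).map (M.wallGen ℤ)).prod := by
  induction l with
  | nil => simp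
  | cons a l ih => simp [ih]

theorem parity_specialCrossing (d : (M.restrict T).ArtinMonoid) (r : M.Group) :
    (M.parity (M.specialCrossing T d).el).val r = ((M.specialCrossing T d).val r : ZMod 2) :=
  M.parity_crossing _ r

/-- An element of the Artin monoid is reduced if it crosses every wall at most once. -/
def IsReducedPositive (d : (M.restrict T).ArtinMonoid) : Prop :=
  ∀ r, (M.specialCrossing T d).val r ≤ 1

variable {M}

theorem IsReducedPositive.of_mul {a b : (M.restrict T).ArtinMonoid}
    (h : M.IsReducedPositive (a * b)) : M.IsReducedPositive b := by
  intro r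
  have h1 := h ((M.specialCrossing T a).el * r * (M.specialCrossing T a).el⁻¹)
  have h2 := M.specialCrossing_nonneg a
    ((M.specialCrossing T a).el * r * (M.specialCrossing T a).el⁻¹)
  rw [map_mul, ConjSemidirect.mul_val] at h1
  simp only [mul_assoc, inv_mul_cancel_left, inv_mul_cancel, mul_one] at h1 h2
  linarith

theorem IsReducedPositive.val_eq {d : (M.restrict T).ArtinMonoid} (h : M.IsReducedPositive d)
    (r : M.Group) :
    (M.specialCrossing T d).val r = 0 ∨ (M.specialCrossing T d).val r = 1 := by
  have h1 := h r
  have h2 := M.specialCrossing_nonneg d r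
  omega

/-- If a reduced element crosses none of the walls of the generators in a set `U`, then it crosses
no wall of the subgroup generated by `U`. -/
theorem IsReducedPositive.val_eq_zero {d : (M.restrict T).ArtinMonoid}
    (h : M.IsReducedPositive d) {U : Set S}
    (hU : ∀ a ∈ U, (M.specialCrossing T d).val (M.simple a) = 0) {r : M.Group}
    (hr : r ∈ M.parabolic U) : (M.specialCrossing T d).val r = 0 := by
  have h0 := M.parity_eq_zero_of_mem_parabolic (w := (M.specialCrossing T d).el)
    (fun a ha => by rw [parity_specialCrossing, hU a ha, Int.cast_zero]) hr
  rw [parity_specialCrossing] at h0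
  refine (h.val_eq r).resolve_right fun h1 => ?_
  rw [h1] at h0
  exact absurd h0 (by decide)

/-- A generator whose wall is crossed by a reduced element divides this element on the left. -/
theorem IsReducedPositive.leftDivides {d : (M.restrict T).ArtinMonoid}
    (h : M.IsReducedPositive d) {s : T} (hs : (M.specialCrossing T d).val (M.simple s) = 1) :
    LeftDivides ((M.restrict T).monoidGen s) d := by
  classical
  obtain ⟨n, hn⟩ : ∃ n, (M.restrict T).wordLength d ≤ n := ⟨_, le_rfl⟩
  induction n generalizing d s with
  | zero =>
    rcases (M.restrict T).artinMonoid_cases d with rfl | ⟨t, d', rfl⟩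
    · simp at hs
    · simp at hn
  | succ n ih =>
  rcases (M.restrict T).artinMonoid_cases d with rfl | ⟨t, d', hd⟩
  · simp at hs
  by_cases hts : t = s
  · exact ⟨d', hts ▸ hd⟩
  have htsS : (t : S) ≠ s := fun e => hts (Subtype.ext e)
  -- the longest alternating word in `t, s` that divides `d`
  let alt : ℕ → (M.restrict T).ArtinMonoid := fun k =>
    ((altWord t s k).map (M.restrict T).monoidGen).prod
  have hbound : ∀ k, LeftDivides (alt k) d → k ≤ (M.restrict T).wordLength d := by
    rintro k ⟨q, rfl⟩
    rw [wordLength_mul, wordLength_prod_map, length_altWord]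
    omega
  have hP1 : LeftDivides (alt 1) d := ⟨d', by simp [alt, altWord, hd]⟩
  obtain ⟨j, hj⟩ : ∃ j, Nat.findGreatest (fun k => LeftDivides (alt k) d)
      ((M.restrict T).wordLength d) = j + 1 :=
    Nat.exists_eq_succ_of_ne_zero (Nat.one_le_iff_ne_zero.1
      (Nat.le_findGreatest (hbound 1 hP1) hP1))
  have hPj : LeftDivides (alt (j + 1)) d := hj ▸ Nat.findGreatest_spec
    (P := fun k => LeftDivides (alt k) d) (hbound 1 hP1) hP1
  have hPj' : ¬ LeftDivides (alt (j + 2)) d := fun hc => by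
    have := Nat.le_findGreatest (P := fun k => LeftDivides (alt k) d) (hbound _ hc) hc
    omega
  obtain ⟨q, hq⟩ := hPj
  obtain ⟨x, y, l, hxy, hl1, hl2⟩ := exists_altWord_succ t s j
  have hdq : d = (l.map (M.restrict T).monoidGen).prod * ((M.restrict T).monoidGen y * q) := by
    rw [hq]
    simp [alt, hl1, mul_assoc]
  have hredy : M.IsReducedPositive ((M.restrict T).monoidGen y * q) :=
    IsReducedPositive.of_mul (hdq ▸ h)
  have hred : M.IsReducedPositive q := hredy.of_mul
  have hlen : (M.restrict T).wordLength q ≤ n := by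
    rw [hdq] at hn
    simp at hn
    omega
  have hx : (M.specialCrossing T q).val (M.simple x) = 0 := by
    refine (hred.val_eq _).resolve_right fun h1 => hPj' ?_
    obtain ⟨q', rfl⟩ := ih hred h1 hlen
    exact ⟨q', by rw [hdq]; simp [alt, hl2, mul_assoc]⟩
  have hy : (M.specialCrossing T q).val (M.simple y) = 0 := by
    have h1 := hredy (M.simple y)
    rw [map_mul, specialCrossing_monoidGen, ConjSemidirect.mul_val, wallGen_val, if_pos rfl,
      wallGen_el, inv_mul_cancel, one_mul] at h1
    have h2 := M.specialCrossing_nonneg q (M.simple y)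
    omega
  -- hence the remaining factor crosses no wall of the dihedral subgroup of `s` and `t`
  have hq0 : ∀ r ∈ M.parabolic {(t : S), (s : S)}, (M.specialCrossing T q).val r = 0 := by
    refine fun r hr => hred.val_eq_zero ?_ hr
    rintro _ (rfl | rfl) <;> rcases hxy with ⟨rfl, rfl⟩ | ⟨rfl, rfl⟩ <;> assumption
  have hel : (M.specialCrossing T (alt (j + 1))).el ∈ M.parabolic {(t : S), (s : S)} := by
    rw [specialCrossing_prod_map, map_val_altWord, el_prod_wallGen]
    have hmem (n : ℕ) : ∀ (a b : S), ∀ c ∈ altWord a b n, c = a ∨ c = b := by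
      induction n with
      | zero => simp [altWord]
      | succ n ih =>
        intro a b c hc
        rcases List.mem_cons.1 hc with rfl | hc
        · exact Or.inl rfl
        · exact (ih b a c hc).symm
    exact ⟨_, hmem _ _ _, rfl⟩
  have hs' : (M.specialCrossing T (alt (j + 1))).val (M.simple s) = 1 := by
    rw [hq, map_mul, ConjSemidirect.mul_val, hq0 _ (mul_mem (mul_mem (inv_mem hel)
      (M.simple_mem_parabolic (by simp))) hel), add_zero] at hs
    exact hs
  -- so the alternating word crosses the wall of `s`, which forces it to have `m_{st}` letters
  rw [specialCrossing_prod_map, map_val_altWord, val_prod_altWord] at hs'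
  obtain ⟨i, hi, hne⟩ := Finset.exists_ne_zero_of_sum_ne_zero (hs'.trans_ne one_ne_zero)
  have hsi : M.simple s = (M.simple t * M.simple s) ^ i * M.simple t := by
    by_contra hc
    exact hne (if_neg hc)
  have hpow : (M.simple t * M.simple s) ^ (i + 1) = 1 := by
    rw [pow_succ, ← mul_assoc, ← hsi, simple_mul_self]
  obtain ⟨hm0, hmle⟩ := M.le_of_simple_mul_simple_pow_eq_one htsS i.succ_ne_zero hpow
  obtain ⟨e, he⟩ := altWord_prefix_add t s (M t s) (j + 1 - M t s)
  have hj1 : M t s + (j + 1 - M t s) = j + 1 := by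
    have := Finset.mem_range.1 hi
    omega
  have hrel := (M.restrict T).prod_altWord_monoidGen hts hm0
  obtain ⟨m, hm⟩ := Nat.exists_eq_succ_of_ne_zero hm0
  have hm' : (M.restrict T) t s = m + 1 := hm
  rw [hm'] at hrel
  rw [hj1, hm] at he
  refine ⟨((altWord t s m).map (M.restrict T).monoidGen).prod *
    (e.map (M.restrict T).monoidGen).prod * q, ?_⟩
  rw [hq]
  simp only [alt, ← he, List.map_append, List.prod_append]
  rw [hrel]
  simp [altWord, mul_assoc]

/-! ### The Garside element crosses every wall at most once -/

theorem finite_parabolic (hT : (M.restrict T).IsFiniteType) : Finite (M.parabolic T) := by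
  have : Finite (M.restrict T).Group := hT
  let f : (M.restrict T).Group →* M.Group :=
    (M.restrict T).toCoxeterSystem.lift ⟨fun s => M.simple s, fun s t =>
      M.simple_mul_simple_pow s t⟩
  have hf (s : T) : f ((M.restrict T).simple s) = M.simple s :=
    (M.restrict T).toCoxeterSystem.lift_apply_simple _ s
  refine (Set.Finite.subset (Set.finite_range f) ?_ : (M.parabolic T : Set M.Group).Finite)
  rintro _ ⟨l, hl, rfl⟩
  lift l to List T using hl
  refine ⟨(l.map (M.restrict T).simple).prod, ?_⟩
  simp [map_list_prod, Function.comp_def, hf]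

/-- Every letter crosses exactly one wall. -/
theorem sum_specialCrossing [Fintype (M.parabolic T)] (d : (M.restrict T).ArtinMonoid) :
    ∑ r : M.parabolic T, (M.specialCrossing T d).val r = (M.restrict T).wordLength d := by
  classical
  induction d using (M.restrict T).artinMonoid_induction with
  | one => simp
  | gen_mul s d ih =>
    let s' : M.parabolic T := ⟨M.simple s, M.simple_mem_parabolic s.2⟩
    have h1 : ∑ r : M.parabolic T, (M.wallGen ℤ s).val r = 1 := by
      rw [Finset.sum_eq_single s']
      · simp [wallGen_val, s']
      · intro r _ hr
        rw [wallGen_val, if_neg fun e => hr (Subtype.ext e)]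
      · simp
    have h2 := (MulAut.conj s'⁻¹).toEquiv.sum_comp fun r : M.parabolic T =>
      (M.specialCrossing T d).val r
    rw [map_mul, wordLength_mul, wordLength_monoidGen, specialCrossing_monoidGen]
    simp only [ConjSemidirect.mul_val, Finset.sum_add_distrib, h1, wallGen_el]
    push_cast
    rw [← ih, ← h2]
    simp [s']

/-- A reduced element of maximal length is a common multiple of all generators. -/
theorem exists_isReducedPositive_leftDivides (hT : (M.restrict T).IsFiniteType) :
    ∃ d : (M.restrict T).ArtinMonoid, M.IsReducedPositive d ∧
      ∀ s, LeftDivides ((M.restrict T).monoidGen s) d := by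
  classical
  have := finite_parabolic hT
  have := Fintype.ofFinite (M.parabolic T)
  let P : ℕ → Prop := fun n => ∃ d : (M.restrict T).ArtinMonoid, M.IsReducedPositive d ∧
    (M.restrict T).wordLength d = n
  have hbound : ∀ d : (M.restrict T).ArtinMonoid, M.IsReducedPositive d →
      (M.restrict T).wordLength d ≤ Fintype.card (M.parabolic T) := by
    intro d hd
    have h1 := sum_specialCrossing d
    have h2 := Finset.sum_le_card_nsmul Finset.univ
      (fun r : M.parabolic T => (M.specialCrossing T d).val r) 1 fun r _ => hd r
    rw [h1] at h2
    simpa using h2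
  have h0 : P 0 := ⟨1, fun r => by simp, rfl⟩
  obtain ⟨d, hd, hlen⟩ := Nat.findGreatest_spec (P := P) (Nat.zero_le _) h0
  refine ⟨d, hd, fun s => ?_⟩
  refine hd.leftDivides ((hd.val_eq _).resolve_left fun hs => ?_)
  have hred : M.IsReducedPositive ((M.restrict T).monoidGen s * d) := by
    intro r
    rw [map_mul, ConjSemidirect.mul_val, specialCrossing_monoidGen, wallGen_val, wallGen_el]
    split_ifs with hr
    · rw [hr, inv_mul_cancel, one_mul, hs, add_zero]
    · rw [zero_add]
      exact hd _
  have := Nat.le_findGreatest (P := P) (hbound _ hred) ⟨_, hred, rfl⟩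
  rw [← hlen, wordLength_mul, wordLength_monoidGen] at this
  omega

variable (M) in
/-- A minimal element is positive and divides a common multiple `Δ_T` of the generators in `T` that
divides a reduced element, so it crosses every wall at most once. -/
theorem crossing_minimalElements {m : M.ArtinGroup} (hm : m ∈ M.minimalElements) (r : M.Group) :
    0 ≤ (M.crossing m).val r ∧ (M.crossing m).val r ≤ 1 := by
  obtain ⟨m, rfl, T, hT, Δ, hΔ, c, hc⟩ := hm
  refine ⟨M.crossing_nonneg m r, ?_⟩
  obtain ⟨d, hd, hdiv⟩ := exists_isReducedPositive_leftDivides hT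
  obtain ⟨e, rfl⟩ := hΔ.1.2 d (by rintro _ ⟨s, rfl⟩; exact hdiv s)
  have h := hd r
  rw [specialCrossing, MonoidHom.comp_apply, MonoidHom.comp_apply, map_mul, hc, mul_assoc, map_mul,
    map_mul, ConjSemidirect.mul_val] at h
  have := M.crossing_nonneg (c * M.specialToMonoid T e)
    ((M.crossing (M.monoidToGroup m)).el⁻¹ * r * (M.crossing (M.monoidToGroup m)).el)
  linarith

end CoxeterMatrix

namespace CoxeterMatrix

universe u

variable {S : Type u} (M : CoxeterMatrix S)

/-! ### The Garside element of two commuting generators -/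

section Commuting

variable {M} {s u : S}

theorem ne_of_label_eq_two (h : M s u = 2) : s ≠ u := by
  rintro rfl
  rw [M.diagonal] at h
  omega

theorem commute_monoidGen (h : M s u = 2) : Commute (M.monoidGen s) (M.monoidGen u) := by
  have := M.prod_altWord_monoidGen (ne_of_label_eq_two h) (by omega)
  rw [h] at this
  simpa [altWord, Commute, SemiconjBy] using this

theorem commute_groupGen (h : M s u = 2) : Commute (M.groupGen s) (M.groupGen u) :=
  (commute_monoidGen h).map M.monoidToGroup

theorem commute_simple (h : M s u = 2) : Commute (M.simple s) (M.simple u) := by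
  have h1 := M.simple_mul_simple_pow s u
  rw [h, pow_two, mul_eq_one_iff_eq_inv] at h1
  rw [Commute, SemiconjBy, h1, mul_inv_rev, simple_inv, simple_inv]

variable (hsurj : ∀ a, a = s ∨ a = u)

include hsurj

theorem exists_eq_pow_mul_pow (h : M s u = 2) (d : M.ArtinMonoid) :
    ∃ i j : ℕ, d = M.monoidGen s ^ i * M.monoidGen u ^ j := by
  induction d using M.artinMonoid_induction with
  | one => exact ⟨0, 0, by simp⟩
  | gen_mul a d ih =>
    obtain ⟨i, j, rfl⟩ := ih
    rcases hsurj a with rfl | rfl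
    · exact ⟨i + 1, j, by rw [pow_succ', mul_assoc]⟩
    · refine ⟨i, j + 1, ?_⟩
      rw [pow_succ', ← mul_assoc, ← mul_assoc, ((commute_monoidGen h).symm.pow_right i).eq]

theorem isGarsideElement_mul (h : M s u = 2) :
    M.IsGarsideElement (M.monoidGen s * M.monoidGen u) := by
  classical
  have hsu := ne_of_label_eq_two h
  have hcomm : ∀ a b : M.ArtinMonoid, a * b = b * a := by
    intro a b
    obtain ⟨i, j, rfl⟩ := exists_eq_pow_mul_pow hsurj h a
    obtain ⟨k, l, rfl⟩ := exists_eq_pow_mul_pow hsurj h b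
    have hc := commute_monoidGen h
    exact (((Commute.refl _).pow_pow i k).mul_right (hc.pow_pow i l)).mul_left
      ((hc.symm.pow_pow j k).mul_right ((Commute.refl _).pow_pow j l))
  -- the number of letters equal to `u`
  let count : M.ArtinMonoid →* Multiplicative ℕ :=
    PresentedMonoid.lift (fun a => Multiplicative.ofAdd (if a = u then 1 else 0)) (by
      rintro _ _ ⟨a, b, hab, -, rfl, rfl⟩
      have h2 : M a b = 2 := by
        rcases hsurj a with rfl | rfl <;> rcases hsurj b with rfl | rfl
        · exact absurd rfl hab
        · exact h
        · rw [M.symmetric, h]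
        · exact absurd rfl hab
      rw [h2]
      simp [altWord, mul_comm])
  have hs : count (M.monoidGen s) = 1 := by
    change Multiplicative.ofAdd (if s = u then 1 else 0) = 1
    rw [if_neg hsu]
    rfl
  have hu : count (M.monoidGen u) = Multiplicative.ofAdd 1 := by
    change Multiplicative.ofAdd (if u = u then 1 else 0) = _
    rw [if_pos rfl]
  have key : ∀ a b : M.ArtinMonoid, M.monoidGen s * a = M.monoidGen u * b →
      LeftDivides (M.monoidGen s * M.monoidGen u) (M.monoidGen s * a) := by
    intro a b hab
    obtain ⟨i, j, rfl⟩ := exists_eq_pow_mul_pow hsurj h a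
    have h1 := congrArg (fun d => (count d).toAdd) hab
    simp only [map_mul, map_pow, hs, hu, one_pow, one_mul, toAdd_mul, toAdd_pow,
      toAdd_ofAdd, smul_eq_mul, mul_one] at h1
    obtain ⟨k, rfl⟩ : ∃ k, j = k + 1 := ⟨j - 1, by omega⟩
    refine ⟨M.monoidGen s ^ i * M.monoidGen u ^ k, ?_⟩
    rw [pow_succ, mul_assoc, ← mul_assoc _ _ (M.monoidGen u), hcomm _ (M.monoidGen u)]
  have hl : IsLcmL (Set.range M.monoidGen) (M.monoidGen s * M.monoidGen u) := by
    refine ⟨?_, fun c hc => ?_⟩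
    · rintro _ ⟨a, rfl⟩
      rcases hsurj a with rfl | rfl
      · exact ⟨_, rfl⟩
      · exact ⟨_, hcomm _ _⟩
    · obtain ⟨a, rfl⟩ := hc _ ⟨s, rfl⟩
      obtain ⟨b, hb⟩ := hc _ ⟨u, rfl⟩
      exact key a b hb
  have hlr : ∀ a b : M.ArtinMonoid, LeftDivides a b ↔ RightDivides a b := fun a b =>
    exists_congr fun c => by rw [hcomm]
  exact ⟨hl, by simpa only [IsLcmL, IsLcmR, hlr] using hl⟩

theorem isFiniteType_of_commuting (h : M s u = 2) : M.IsFiniteType := by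
  have hc := commute_simple h
  have hsub : (Set.univ : Set M.Group) ⊆ {1, M.simple s, M.simple u, M.simple s * M.simple u} := by
    rintro w -
    induction w using M.toCoxeterSystem.simple_induction_left with
    | one => simp
    | mul_simple_left w a ih =>
      rw [toCoxeterSystem_simple]
      have hs := M.simple_mul_self s
      have hu := M.simple_mul_self u
      rcases ih with rfl | rfl | rfl | rfl <;> rcases hsurj a with rfl | rfl
      · simp
      · simp
      · simp [hs]
      · simp [hc.eq]
      · simp
      · simp [hu]
      · simp [← mul_assoc, hs]
      · rw [hc.eq, ← mul_assoc, hu]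
        simp
  exact Set.finite_univ_iff.1 (Set.Finite.subset (by simp) hsub)

end Commuting

/-- All three elements divide the Garside element `s u` of the subset `{s, u}`. -/
theorem mem_minimalElements_of_commuting {s u : S} (h : M s u = 2) :
    M.groupGen s ∈ M.minimalElements ∧ M.groupGen u ∈ M.minimalElements ∧
      M.groupGen s * M.groupGen u ∈ M.minimalElements := by
  have hs : s ∈ ({s, u} : Set S) := by simp
  have hu : u ∈ ({s, u} : Set S) := by simp
  have hsurj : ∀ a : ({s, u} : Set S), a = ⟨s, hs⟩ ∨ a = ⟨u, hu⟩ := by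
    rintro ⟨a, rfl | rfl⟩
    · exact Or.inl rfl
    · exact Or.inr rfl
  have h' : (M.restrict {s, u}) ⟨s, hs⟩ ⟨u, hu⟩ = 2 := h
  have hmem (m c : M.ArtinMonoid) (hc : M.monoidGen s * M.monoidGen u = m * c) :
      M.monoidToGroup m ∈ M.minimalElements :=
    ⟨m, rfl, {s, u}, isFiniteType_of_commuting hsurj h', _, isGarsideElement_mul hsurj h', c,
      by rw [map_mul]; exact hc⟩
  refine ⟨hmem (M.monoidGen s) _ rfl, hmem (M.monoidGen u) _ (commute_monoidGen h).eq, ?_⟩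
  have := hmem (M.monoidGen s * M.monoidGen u) 1 (mul_one _).symm
  rwa [map_mul] at this

end CoxeterMatrix

/-! ### Lipschitz functions and lines in a graph -/

namespace SimpleGraph

variable {V : Type*} {G : SimpleGraph V}

/-- An integer-valued function on the vertices that changes by at most one along each edge. -/
def IsShort (G : SimpleGraph V) (h : V → ℤ) : Prop :=
  ∀ a b, G.Adj a b → |h a - h b| ≤ 1

theorem IsShort.abs_sub_le {h : V → ℤ} (hh : G.IsShort h) {a b : V} (p : G.Walk a b) :
    |h a - h b| ≤ p.length := by
  induction p with
  | nil => simp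
  | cons hab p ih =>
    rw [Walk.length_cons]
    push_cast
    have h1 := hh _ _ hab
    rw [abs_le] at *
    constructor <;> linarith

theorem IsShort.le_edist {h : V → ℤ} (hh : G.IsShort h) {a b : V} {n : ℕ}
    (hn : n ≤ |h a - h b|) : (n : ℕ∞) ≤ G.edist a b := by
  by_cases hr : G.edist a b = ⊤
  · simp [hr]
  · obtain ⟨p, hp⟩ := G.exists_walk_of_edist_ne_top hr
    rw [← hp]
    have := hh.abs_sub_le p
    exact_mod_cast hn.trans this

theorem IsShort.ofReal_le_edist {h : V → ℤ} (hh : G.IsShort h) (a b : V) :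
    ENNReal.ofReal |(h a : ℝ) - h b| ≤ (G.edist a b : ℝ≥0∞) := by
  have h1 := hh.le_edist (a := a) (b := b) (n := |h a - h b|.toNat) (by simp)
  have h2 : |(h a : ℝ) - h b| = (|h a - h b|.toNat : ℝ) := by
    have h3 : ((|h a - h b|.toNat : ℤ) : ℝ) = ((|h a - h b| : ℤ) : ℝ) := by
      rw [Int.toNat_of_nonneg (abs_nonneg _)]
    rw [Int.cast_natCast] at h3
    rw [h3]
    push_cast
    rfl
  rw [h2, ENNReal.ofReal_natCast]
  exact_mod_cast ENat.toENNReal_le.2 h1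

theorem exists_walk_getVert (f : ℕ → V) (n : ℕ) (hf : ∀ i < n, G.Adj (f i) (f (i + 1))) :
    ∃ p : G.Walk (f 0) (f n), p.length = n ∧ ∀ i ≤ n, p.getVert i = f i := by
  induction n generalizing f with
  | zero => exact ⟨.nil, rfl, by simp⟩
  | succ n ih =>
    obtain ⟨p, hp, hv⟩ := ih (fun i => f (i + 1)) fun i hi => hf (i + 1) (by omega)
    refine ⟨.cons (hf 0 (by omega)) p, by simp [hp], fun i hi => ?_⟩
    rcases i with _ | i
    · simp
    · simpa using hv i (by omega)

namespace Realization

/-- The linear extension to the realization of a function on the vertices. -/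
noncomputable def extend (h : V → ℤ) (x : G.Realization) : ℝ :=
  x.coord.sum fun v r => r * h v

theorem extend_eq (h : V → ℤ) (x : G.Realization) {a b : V}
    (hx : (x.coord.support : Set V) ⊆ {a, b}) :
    extend h x = x.coord a * (h a - h b) + h b := by
  classical
  rcases eq_or_ne a b with rfl | hab
  · have h' : x.coord.support ⊆ {a} := by
      intro v hv
      simpa using hx hv
    rw [extend, Finsupp.sum_of_support_subset _ h' _ (by simp), Finset.sum_singleton,
      coord_eq_one x (by exact_mod_cast h')]
    ring
  · have h' : x.coord.support ⊆ {a, b} := fun e he => by simpa using hx he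
    rw [extend, Finsupp.sum_of_support_subset _ h' _ (by simp), Finset.sum_pair hab]
    have := coord_add_coord x hab hx
    rw [show x.coord b = 1 - x.coord a by linarith]
    ring

theorem abs_extend_sub_le_vertexDist {h : V → ℤ} (hh : G.IsShort h) (x : G.Realization) (v : V) :
    ENNReal.ofReal |extend h x - h v| ≤ vertexDist x v := by
  refine le_iInf₂ fun a ha => ?_
  refine le_trans ?_ (add_le_add le_rfl (hh.ofReal_le_edist a v))
  rw [← ENNReal.ofReal_add (by linarith [x.coord_le_one a]) (abs_nonneg _)]
  refine ENNReal.ofReal_le_ofReal ?_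
  obtain ⟨b, hab, hx⟩ : ∃ b, (a = b ∨ G.Adj a b) ∧ (x.coord.support : Set V) ⊆ {a, b} := by
    obtain ⟨p, q, hpq, hx⟩ := x.support_subset
    rcases hx ha with rfl | rfl
    · exact ⟨q, hpq, hx⟩
    · exact ⟨p, hpq.imp Eq.symm Adj.symm, by rwa [Set.pair_comm]⟩
  have h1 : |(h a : ℝ) - h b| ≤ 1 := by
    rcases hab with rfl | hab
    · simp
    · exact_mod_cast hh a b hab
  have h2 : |extend h x - h a| ≤ 1 - x.coord a := by
    rw [extend_eq h x hx, show x.coord a * ((h a : ℝ) - h b) + h b - h a =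
      -((1 - x.coord a) * (h a - h b)) by ring, abs_neg, abs_mul,
      abs_of_nonneg (by linarith [x.coord_le_one a])]
    nlinarith [x.coord_le_one a]
  calc |extend h x - h v| ≤ |extend h x - h a| + |(h a : ℝ) - h v| := _root_.abs_sub_le _ _ _
    _ ≤ _ := by gcongr

/-- The linear extension of a short function is `1`-Lipschitz. -/
theorem abs_extend_sub_le_edist {h : V → ℤ} (hh : G.IsShort h) (x y : G.Realization) :
    ENNReal.ofReal |extend h x - extend h y| ≤ EDist.edist x y := by
  refine le_min ?_ (le_iInf fun v => ?_)
  · refine le_iInf₂ fun a b => le_iInf fun ⟨hab, hx, hy⟩ => ENNReal.ofReal_le_ofReal ?_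
    have h1 : |(h a : ℝ) - h b| ≤ 1 := by
      rcases hab with rfl | hab
      · simp
      · exact_mod_cast hh a b hab
    rw [extend_eq h x hx, extend_eq h y hy, show x.coord a * ((h a : ℝ) - h b) + h b -
      (y.coord a * (h a - h b) + h b) = (x.coord a - y.coord a) * (h a - h b) by ring, abs_mul]
    exact mul_le_of_le_one_right (abs_nonneg _) h1
  · refine le_trans ?_ (add_le_add (abs_extend_sub_le_vertexDist hh x v)
      (abs_extend_sub_le_vertexDist hh y v))
    rw [← ENNReal.ofReal_add (abs_nonneg _) (abs_nonneg _)]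
    refine ENNReal.ofReal_le_ofReal ?_
    rw [abs_sub_comm (extend h y)]
    exact _root_.abs_sub_le _ _ _

/-- The point of the edge from `a` to `b` at distance `r` from `a`. -/
noncomputable def edgePoint {a b : V} (hab : G.Adj a b) (r : ℝ) (h0 : 0 ≤ r) (h1 : r ≤ 1) :
    G.Realization where
  coord := Finsupp.single a (1 - r) + Finsupp.single b r
  nonneg v := by
    classical
    simp only [Finsupp.add_apply, Finsupp.single_apply]
    split_ifs <;> linarith
  sum_eq_one := by
    classical
    rw [Finsupp.sum_add_index' (by simp) (by simp), Finsupp.sum_single_index rfl,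
      Finsupp.sum_single_index rfl]
    ring
  support_subset := ⟨a, b, Or.inr hab, by
    classical
    intro v hv
    by_contra hn
    simp only [Set.mem_insert_iff, Set.mem_singleton_iff, not_or] at hn
    simp [Ne.symm hn.1, Ne.symm hn.2] at hv⟩

section edgePoint

variable {a b : V} (hab : G.Adj a b) (r : ℝ) (h0 : 0 ≤ r) (h1 : r ≤ 1)

theorem edgePoint_coord_left : (edgePoint hab r h0 h1).coord a = 1 - r := by
  simp [edgePoint, hab.ne]

theorem edgePoint_coord_right : (edgePoint hab r h0 h1).coord b = r := by
  simp [edgePoint, hab.ne']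

theorem edgePoint_support : ((edgePoint hab r h0 h1).coord.support : Set V) ⊆ {a, b} := by
  classical
  intro v hv
  by_contra hn
  simp only [Set.mem_insert_iff, Set.mem_singleton_iff, not_or] at hn
  simp [edgePoint, Ne.symm hn.1, Ne.symm hn.2] at hv

theorem extend_edgePoint (h : V → ℤ) :
    extend h (edgePoint hab r h0 h1) = (1 - r) * h a + r * h b := by
  rw [extend_eq h _ (edgePoint_support hab r h0 h1), edgePoint_coord_left]
  ring

end edgePoint

/-- The path in the realization that runs with unit speed through a two-sided sequence of
successively adjacent vertices. -/
noncomputable def line (f : ℤ → V) (hf : ∀ i, G.Adj (f i) (f (i + 1))) (r : ℝ) : G.Realization :=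
  edgePoint (hf ⌊r⌋) (Int.fract r) (Int.fract_nonneg r) (Int.fract_lt_one r).le

section line

variable (f : ℤ → V) (hf : ∀ i, G.Adj (f i) (f (i + 1)))

theorem vertexDist_line_le (r : ℝ) (j : ℤ) :
    (r ≤ j → vertexDist (line f hf r) (f j) ≤ ENNReal.ofReal (j - r)) ∧
      (j = ⌊r⌋ → vertexDist (line f hf r) (f j) ≤ ENNReal.ofReal (r - j)) := by
  have hfr := Int.self_sub_floor r
  have hlt := Int.fract_lt_one r
  have hnn := Int.fract_nonneg r
  have hleft : f ⌊r⌋ ∈ (line f hf r).coord.support := by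
    rw [Finsupp.mem_support_iff, line, edgePoint_coord_left]
    linarith
  have hdist (i : ℤ) (n : ℕ) : G.edist (f i) (f (i + n)) ≤ n := by
    obtain ⟨p, hp, -⟩ := exists_walk_getVert (G := G) (fun k : ℕ => f (i + k)) n
      fun k _ => by simpa [add_assoc] using hf (i + k)
    have := G.edist_le p
    simpa [hp] using this
  have hdist' (i : ℤ) (h : i ≤ j) :
      (G.edist (f i) (f j) : ℝ≥0∞) ≤ ENNReal.ofReal (j - i) := by
    obtain ⟨n, rfl⟩ := Int.le.dest h
    have := ENat.toENNReal_le.2 (hdist i n)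
    simpa using this
  constructor
  · intro hrj
    rcases hnn.eq_or_lt with h0 | h0
    · refine (vertexDist_le _ _ hleft).trans ?_
      have hle : ⌊r⌋ ≤ j := Int.cast_le.1 ((Int.floor_le r).trans hrj)
      refine (add_le_add le_rfl (hdist' _ hle)).trans ?_
      have h1 : (⌊r⌋ : ℝ) = r := by linarith
      rw [line, edgePoint_coord_left, ← h0, h1]
      simp
    · have hright : f (⌊r⌋ + 1) ∈ (line f hf r).coord.support := by
        rw [Finsupp.mem_support_iff, line, edgePoint_coord_right]
        exact h0.ne'
      refine (vertexDist_le _ _ hright).trans ?_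
      have hlt' : ⌊r⌋ < j := Int.cast_lt.1 (show (⌊r⌋ : ℝ) < j by linarith)
      refine (add_le_add le_rfl (hdist' _ hlt')).trans ?_
      have h2 : ((⌊r⌋ + 1 : ℤ) : ℝ) ≤ j := Int.cast_le.2 hlt'
      rw [line, edgePoint_coord_right, ← ENNReal.ofReal_add (by linarith) (by linarith)]
      refine ENNReal.ofReal_le_ofReal ?_
      push_cast
      linarith
  · rintro rfl
    refine (vertexDist_le _ _ hleft).trans ?_
    rw [edist_self, line, edgePoint_coord_left]
    simp

theorem edist_line_le (r r' : ℝ) :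
    EDist.edist (line f hf r) (line f hf r') ≤ ENNReal.ofReal |r - r'| := by
  wlog h : r ≤ r' generalizing r r'
  · rw [PseudoEMetricSpace.edist_comm, abs_sub_comm]
    exact this r' r (le_of_not_ge h)
  have e1 := Int.self_sub_floor r
  have e2 := Int.self_sub_floor r'
  rcases (Int.floor_mono h).eq_or_lt with he | hlt
  · refine (min_le_left _ _).trans ((iInf₂_le (f ⌊r⌋) (f (⌊r⌋ + 1))).trans
      ((iInf_le _ ⟨Or.inr (hf _), edgePoint_support _ _ _ _, ?_⟩).trans ?_))
    · have h1 : (line f hf r).coord (f ⌊r⌋) = 1 - Int.fract r := edgePoint_coord_left _ _ _ _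
      have h2 : (line f hf r').coord (f ⌊r⌋) = 1 - Int.fract r' := by
        rw [he]
        exact edgePoint_coord_left _ _ _ _
      rw [h1, h2, ← e1, ← e2, he, abs_sub_comm r]
      refine ENNReal.ofReal_le_ofReal (le_of_eq ?_)
      congr 1
      ring
    · rw [he]
      exact edgePoint_support _ _ _ _
  · have hle : r ≤ ⌊r'⌋ := by
      have h1 : ((⌊r⌋ + 1 : ℤ) : ℝ) ≤ ⌊r'⌋ := Int.cast_le.2 hlt
      push_cast at h1
      linarith [Int.lt_floor_add_one r]
    refine (min_le_right _ _).trans ((iInf_le _ (f ⌊r'⌋)).trans ?_)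
    refine (add_le_add ((vertexDist_line_le f hf r _).1 hle)
      ((vertexDist_line_le f hf r' _).2 rfl)).trans ?_
    rw [← ENNReal.ofReal_add (by linarith) (by linarith [Int.floor_le r']), abs_sub_comm,
      abs_of_nonneg (by linarith)]
    refine ENNReal.ofReal_le_ofReal ?_
    linarith

theorem line_coord_intCast (i : ℤ) : (line f hf i).coord = Finsupp.single (f i) 1 := by
  simp [line, edgePoint]

/-- Along a line on which a short function grows with unit speed, the linear extension of that
function bounds distances from below, so the line is geodesic. -/
theorem isGeodesicPath_line {h : V → ℤ} (hh : G.IsShort h) (c : ℤ) (hc : ∀ i, h (f i) = i + c)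
    (n : ℝ) (L : ℝ) : IsGeodesicPath (fun r => line f hf (r - n)) L := by
  have hext (r : ℝ) : extend h (line f hf r) = r + c := by
    rw [line, extend_edgePoint, hc, hc, ← Int.self_sub_floor]
    push_cast
    ring
  intro r _ r' _
  refine le_antisymm ((edist_line_le f hf _ _).trans_eq ?_) (le_trans (le_of_eq ?_)
    (abs_extend_sub_le_edist hh _ _))
  · congr 2
    ring
  · rw [hext, hext]
    congr 2
    ring

end line

end Realization

end SimpleGraph

namespace CoxeterMatrix

universe u

variable {S : Type u} (M : CoxeterMatrix S)

/-! ### Crossing numbers along the edges of the Cayley graph -/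

theorem crossing_sub_of_adj {g h : M.ArtinGroup} (hgh : M.cayleyGraph.Adj g h) :
    (∀ r, 0 ≤ (M.crossing h).val r - (M.crossing g).val r ∧
        (M.crossing h).val r - (M.crossing g).val r ≤ 1) ∨
      ∀ r, 0 ≤ (M.crossing g).val r - (M.crossing h).val r ∧
        (M.crossing g).val r - (M.crossing h).val r ≤ 1 := by
  have key (g m : M.ArtinGroup) (hm : m ∈ M.minimalElements) (r : M.Group) :
      0 ≤ (M.crossing (g * m)).val r - (M.crossing g).val r ∧
        (M.crossing (g * m)).val r - (M.crossing g).val r ≤ 1 := by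
    rw [map_mul, ConjSemidirect.mul_val, add_sub_cancel_left]
    exact M.crossing_minimalElements hm _
  obtain ⟨-, m, hm, rfl | rfl⟩ := (SimpleGraph.mulCayley_adj' _ _ _).1 hgh
  · exact Or.inl (key g m hm)
  · exact Or.inr (key h m hm)

theorem isShort_crossing (r : M.Group) : M.cayleyGraph.IsShort fun g => (M.crossing g).val r := by
  intro g h hgh
  rw [abs_le]
  rcases M.crossing_sub_of_adj hgh with H | H <;> constructor <;> linarith [(H r).1, (H r).2]

/-- Along an edge all crossing numbers change in the same direction, so that the difference of two
of them changes by at most one, too. -/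
theorem isShort_crossing_sub (r r' : M.Group) :
    M.cayleyGraph.IsShort fun g => (M.crossing g).val r - (M.crossing g).val r' := by
  intro g h hgh
  rw [abs_le]
  rcases M.crossing_sub_of_adj hgh with H | H <;> constructor <;>
    linarith [(H r).1, (H r).2, (H r').1, (H r').2]

theorem simple_ne_simple {s t : S} (hst : s ≠ t) : M.simple s ≠ M.simple t := by
  intro h
  have h1 := M.le_of_simple_mul_simple_pow_eq_one hst one_ne_zero
    (by rw [h, simple_mul_self, one_pow])
  have h2 := M.off_diagonal s t hst
  omega

open Classical in
theorem crossing_pow_val (a : S) (n : ℕ) (r : M.Group) :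
    (M.crossing (M.groupGen a ^ n)).val r = if r = M.simple a then (n : ℤ) else 0 := by
  induction n generalizing r with
  | zero => simp
  | succ n ih =>
    have h : (M.simple a)⁻¹ * r * M.simple a = M.simple a ↔ r = M.simple a := by
      rw [mul_assoc, inv_mul_eq_iff_eq_mul, mul_left_inj]
    rw [pow_succ', map_mul, ConjSemidirect.mul_val, ih, crossing_groupGen, wallGen_val, wallGen_el]
    simp only [h]
    split_ifs
    · push_cast
      ring
    · simp

theorem crossing_el_pow (a : S) (n : ℕ) :
    (M.crossing (M.groupGen a ^ n)).el = M.simple a ^ n := by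
  rw [map_pow, crossing_groupGen]
  exact map_pow ConjSemidirect.elHom _ n

open Classical in
theorem crossing_inv_pow_val (a : S) (n : ℕ) (r : M.Group) :
    (M.crossing (M.groupGen a ^ n)⁻¹).val r = if r = M.simple a then -(n : ℤ) else 0 := by
  have h : M.simple a ^ n * r * (M.simple a ^ n)⁻¹ = M.simple a ↔ r = M.simple a := by
    rw [mul_inv_eq_iff_eq_mul, ← pow_succ', pow_succ, mul_right_inj]
  rw [map_inv, ConjSemidirect.inv_val, crossing_el_pow, crossing_pow_val]
  simp only [h]
  split_ifs <;> simp

variable {M} in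
/-- Multiplication of a generator by one that commutes with it changes only the crossing number of
the wall of the latter. -/
theorem crossing_inv_pow_mul_pow_val {a u : S} (hau : M a u = 2) (n i : ℕ) {r : M.Group}
    (hr : r ≠ M.simple u) (hr' : M.simple a ^ i * M.simple u * (M.simple a ^ i)⁻¹ = M.simple u) :
    (M.crossing ((M.groupGen u ^ n)⁻¹ * (M.groupGen a * M.groupGen u) ^ i)).val r =
      (M.crossing (M.groupGen a ^ i)).val r := by
  classical
  have hc := commute_groupGen hau
  have h1 : (M.groupGen u ^ n)⁻¹ * (M.groupGen a * M.groupGen u) ^ i =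
      M.groupGen a ^ i * ((M.groupGen u ^ n)⁻¹ * M.groupGen u ^ i) := by
    rw [hc.mul_pow, ← mul_assoc, ← mul_assoc, ((hc.pow_pow i n).inv_right).eq]
  have h2 : ∀ r, r ≠ M.simple u →
      (M.crossing ((M.groupGen u ^ n)⁻¹ * M.groupGen u ^ i)).val r = 0 := by
    intro r hr
    rw [map_mul, ConjSemidirect.mul_val, crossing_inv_pow_val, if_neg hr, zero_add,
      crossing_pow_val, if_neg]
    rw [map_inv, ConjSemidirect.inv_el, crossing_el_pow, inv_inv, mul_inv_eq_iff_eq_mul,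
      ← pow_succ', pow_succ, mul_right_inj]
    exact hr
  rw [h1, map_mul, ConjSemidirect.mul_val, h2, add_zero]
  intro he
  apply hr
  rw [crossing_el_pow] at he
  rw [← hr', ← he]
  simp [mul_assoc]

/-! ### Geodesics made of two rays -/

/-- The two-sided sequence of group elements that follows the powers of `p` backwards to `x` and
then the powers of `q`. -/
def twoRays {A : Type*} [Monoid A] (x p q : A) (j : ℤ) : A :=
  if 0 ≤ j then x * q ^ j.toNat else x * p ^ (-j).toNat

section twoRays

theorem twoRays_natCast {A : Type*} [Monoid A] (x p q : A) (i : ℕ) :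
    twoRays x p q i = x * q ^ i := by
  simp [twoRays]

theorem twoRays_neg_natCast {A : Type*} [Monoid A] (x p q : A) (i : ℕ) :
    twoRays x p q (-i) = x * p ^ i := by
  rcases i with _ | i
  · simp [twoRays]
  · rw [twoRays, if_neg (by omega)]
    simp

variable {M} {x p q : M.ArtinGroup} {h : M.ArtinGroup → ℤ}

theorem apply_twoRays (hp : ∀ i : ℕ, h (x * p ^ i) = -i) (hq : ∀ i : ℕ, h (x * q ^ i) = i) (j : ℤ) :
    h (twoRays x p q j) = j := by
  obtain ⟨i, rfl | rfl⟩ := j.eq_nat_or_neg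
  · rw [twoRays_natCast, hq]
  · rw [twoRays_neg_natCast, hp]

variable (hpM : p ∈ M.minimalElements) (hqM : q ∈ M.minimalElements)
  (hp : ∀ i : ℕ, h (x * p ^ i) = -i) (hq : ∀ i : ℕ, h (x * q ^ i) = i)

include hpM hqM hp hq

theorem adj_twoRays (j : ℤ) :
    M.cayleyGraph.Adj (twoRays x p q j) (twoRays x p q (j + 1)) := by
  refine (SimpleGraph.mulCayley_adj' _ _ _).2 ⟨fun he => ?_, ?_⟩
  · have := congrArg h he
    rw [apply_twoRays hp hq, apply_twoRays hp hq] at this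
    omega
  · rcases le_or_gt 0 j with hj | hj
    · obtain ⟨i, rfl⟩ := Int.eq_ofNat_of_zero_le hj
      refine ⟨q, hqM, Or.inl ?_⟩
      rw [show (i : ℤ) + 1 = ((i + 1 : ℕ) : ℤ) by push_cast; rfl, twoRays_natCast,
        twoRays_natCast, mul_assoc, pow_succ]
    · obtain ⟨i, hi⟩ := Int.eq_ofNat_of_zero_le (show 0 ≤ -(j + 1) by omega)
      obtain rfl : j = -((i + 1 : ℕ) : ℤ) := by push_cast; omega
      refine ⟨p, hpM, Or.inr ?_⟩
      rw [show -((i + 1 : ℕ) : ℤ) + 1 = -(i : ℤ) by push_cast; ring, twoRays_neg_natCast,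
        twoRays_neg_natCast, mul_assoc, pow_succ]

theorem exists_geodesic_walk (hh : M.cayleyGraph.IsShort h) (n : ℕ) {a b : M.ArtinGroup}
    (ha : a = x * p ^ n) (hb : b = x * q ^ n) :
    ∃ γ : M.cayleyGraph.Walk a b, γ.IsGeodesic ∧ γ.length = 2 * n ∧
      (∀ i ≤ n, γ.getVert i = x * p ^ (n - i)) ∧ ∀ i ≤ n, γ.getVert (n + i) = x * q ^ i := by
  obtain ⟨γ, hl, hv⟩ := SimpleGraph.exists_walk_getVert (G := M.cayleyGraph)
    (fun i : ℕ => twoRays x p q (i - n)) (2 * n) (fun i _ => by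
      have := adj_twoRays hpM hqM hp hq ((i : ℤ) - n)
      rwa [show (i : ℤ) - n + 1 = ((i + 1 : ℕ) : ℤ) - n by push_cast; ring] at this)
  have h1 (i : ℕ) (hi : i ≤ n) : twoRays x p q ((i : ℤ) - n) = x * p ^ (n - i) := by
    rw [← twoRays_neg_natCast x p q (n - i)]
    congr 1
    omega
  have h2 (i : ℕ) : twoRays x p q (((n + i : ℕ) : ℤ) - n) = x * q ^ i := by
    rw [← twoRays_natCast x p q i]
    congr 1
    omega
  obtain rfl : a = twoRays x p q ((0 : ℕ) - n) := by rw [ha, h1 0 (Nat.zero_le n), Nat.sub_zero]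
  obtain rfl : b = twoRays x p q ((2 * n : ℕ) - n) := by rw [hb, two_mul, h2]
  refine ⟨γ, le_antisymm ?_ (SimpleGraph.edist_le γ), hl, fun i hi => ?_, fun i hi => ?_⟩
  · rw [hl]
    refine hh.le_edist ?_
    rw [apply_twoRays hp hq, apply_twoRays hp hq, abs_sub_comm]
    refine le_trans (le_of_eq ?_) (le_abs_self _)
    push_cast
    ring
  · rw [hv i (by omega), h1 i hi]
  · rw [hv (n + i) (by omega), h2]

end twoRays

/-! ### Failure of quasi-convexity -/

theorem groupGen_pow_mem_positiveElements (a : S) (n : ℕ) :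
    M.groupGen a ^ n ∈ M.positiveElements :=
  pow_mem (MonoidHom.mem_mrange.2 ⟨M.monoidGen a, rfl⟩) n

theorem natCast_le_edist_positiveElements (u : S) (n : ℕ) {v : M.ArtinGroup}
    (hv : v ∈ M.positiveElements) :
    (n : ℕ∞) ≤ M.cayleyGraph.edist (M.groupGen u ^ n)⁻¹ v := by
  obtain ⟨d, rfl⟩ := hv
  refine (M.isShort_crossing (M.simple u)).le_edist ?_
  have h1 := M.crossing_nonneg d (M.simple u)
  rw [crossing_inv_pow_val, if_pos rfl, abs_sub_comm]
  exact le_trans (by linarith) (le_abs_self _)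

variable {M} {s t u : S}

section

variable (hst : s ≠ t) (hsu : M s u = 2) (htu : M t u = 2)

include hst

theorem crossing_sub_pow (i : ℕ) :
    (M.crossing (M.groupGen s ^ i)).val (M.simple t) -
        (M.crossing (M.groupGen s ^ i)).val (M.simple s) = -i ∧
      (M.crossing (M.groupGen t ^ i)).val (M.simple t) -
        (M.crossing (M.groupGen t ^ i)).val (M.simple s) = i := by
  classical
  have h := M.simple_ne_simple hst
  simp only [crossing_pow_val, if_true, if_neg h, if_neg h.symm, zero_sub, sub_zero, and_self]

include hsu htu

theorem crossing_sub_inv_pow_mul_pow (n i : ℕ) :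
    (M.crossing ((M.groupGen u ^ n)⁻¹ * (M.groupGen s * M.groupGen u) ^ i)).val (M.simple t) -
        (M.crossing ((M.groupGen u ^ n)⁻¹ * (M.groupGen s * M.groupGen u) ^ i)).val (M.simple s) =
          -i ∧
      (M.crossing ((M.groupGen u ^ n)⁻¹ * (M.groupGen t * M.groupGen u) ^ i)).val (M.simple t) -
        (M.crossing ((M.groupGen u ^ n)⁻¹ * (M.groupGen t * M.groupGen u) ^ i)).val (M.simple s) =
          i := by
  have hs := M.simple_ne_simple (ne_of_label_eq_two hsu)
  have ht := M.simple_ne_simple (ne_of_label_eq_two htu)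
  have hconj {a : S} (h : M a u = 2) (i : ℕ) :
      M.simple a ^ i * M.simple u * (M.simple a ^ i)⁻¹ = M.simple u := by
    rw [((commute_simple h).pow_left i).eq, mul_inv_cancel_right]
  rw [crossing_inv_pow_mul_pow_val hsu n i hs (hconj hsu i),
    crossing_inv_pow_mul_pow_val hsu n i ht (hconj hsu i),
    crossing_inv_pow_mul_pow_val htu n i hs (hconj htu i),
    crossing_inv_pow_mul_pow_val htu n i ht (hconj htu i)]
  exact crossing_sub_pow hst i

theorem not_isQuasiConvex_monoidCayleyGraph : ¬ IsQuasiConvex M.monoidCayleyGraph := by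
  rintro ⟨N, -, hN⟩
  obtain ⟨n, hn⟩ := exists_nat_ge N
  let h : M.ArtinGroup → ℤ := fun g =>
    (M.crossing g).val (M.simple t) - (M.crossing g).val (M.simple s)
  have hp (i : ℕ) : h ((M.groupGen u ^ n)⁻¹ * (M.groupGen s * M.groupGen u) ^ i) = -i :=
    (crossing_sub_inv_pow_mul_pow hst hsu htu n i).1
  have hq (i : ℕ) : h ((M.groupGen u ^ n)⁻¹ * (M.groupGen t * M.groupGen u) ^ i) = i :=
    (crossing_sub_inv_pow_mul_pow hst hsu htu n i).2
  have hadj := adj_twoRays (M.mem_minimalElements_of_commuting hsu).2.2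
    (M.mem_minimalElements_of_commuting htu).2.2 hp hq
  have hend {a : S} (ha : M a u = 2) :
      (M.groupGen u ^ n)⁻¹ * (M.groupGen a * M.groupGen u) ^ n ∈ M.positiveElements := by
    rw [(commute_groupGen ha).mul_pow, ((commute_groupGen ha).pow_pow n n).eq,
      inv_mul_cancel_left]
    exact M.groupGen_pow_mem_positiveElements a n
  have hmem {f : ℤ → M.ArtinGroup} (hf : ∀ i, M.cayleyGraph.Adj (f i) (f (i + 1))) (i : ℤ)
      (hi : f i ∈ M.positiveElements) :
      SimpleGraph.Realization.line f hf i ∈ M.monoidCayleyGraph := by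
    intro v hv
    rw [SimpleGraph.Realization.line_coord_intCast] at hv
    obtain rfl : v = f i := by simpa using hv
    exact hi
  have hmid := hN (2 * n) _ (by positivity) (SimpleGraph.Realization.isGeodesicPath_line _ hadj
    (M.isShort_crossing_sub (M.simple t) (M.simple s)) 0
    (fun i => (apply_twoRays hp hq i).trans (add_zero i).symm) n (2 * n))
    (by
      have := hmem hadj (-n) (by rw [twoRays_neg_natCast]; exact hend hsu)
      simpa using this)
    (by
      have := hmem hadj n (by rw [twoRays_natCast]; exact hend htu)
      simpa [two_mul] using this)
    n ⟨by positivity, by linarith [(Nat.cast_nonneg n : (0 : ℝ) ≤ n)]⟩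
  obtain ⟨y, hy, hlt⟩ := (Metric.mem_thickening_iff_exists_edist_lt _ _).1 hmid
  -- the crossing number of the wall of `u` is `-n` at the midpoint and nonnegative on `𝒢⁺`
  have hle := SimpleGraph.Realization.abs_extend_sub_le_edist
    (M.isShort_crossing (M.simple u))
    (SimpleGraph.Realization.line _ hadj ((n : ℝ) - n)) y
  have h1 : SimpleGraph.Realization.extend (fun g => (M.crossing g).val (M.simple u))
      (SimpleGraph.Realization.line _ hadj ((n : ℝ) - n)) = -n := by
    have hc := SimpleGraph.Realization.line_coord_intCast _ hadj 0
    have h0 : twoRays (M.groupGen u ^ n)⁻¹ (M.groupGen s * M.groupGen u)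
        (M.groupGen t * M.groupGen u) 0 = (M.groupGen u ^ n)⁻¹ := by simp [twoRays]
    rw [sub_self, SimpleGraph.Realization.extend, ← Int.cast_zero, hc, h0,
      Finsupp.sum_single_index (by simp), crossing_inv_pow_val, if_pos rfl]
    simp
  have h2 : 0 ≤ SimpleGraph.Realization.extend (fun g => (M.crossing g).val (M.simple u)) y := by
    refine Finset.sum_nonneg fun v hv => mul_nonneg (y.nonneg v) ?_
    obtain ⟨d, rfl⟩ := hy hv
    exact_mod_cast M.crossing_nonneg d _
  have h3 := hle.trans_lt hlt
  rw [h1] at h3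
  have h4 := (ENNReal.ofReal_lt_ofReal_iff_of_nonneg (abs_nonneg _)).1 h3
  rw [abs_sub_comm] at h4
  linarith [le_abs_self (SimpleGraph.Realization.extend
    (fun g => (M.crossing g).val (M.simple u)) y - -(n : ℝ))]

end

end CoxeterMatrix

theorem mainTheorem5 :
    (∀ {S : Type*} [Finite S] (M : CoxeterMatrix S) (s t u : S),
      s ≠ t → M s u = 2 → M t u = 2 →
        ¬ IsQuasiConvex M.monoidCayleyGraph ∧
        ∀ n : ℕ,
          (∃ γ : M.cayleyGraph.Walk (M.groupGen s ^ n) (M.groupGen t ^ n),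
            γ.IsGeodesic ∧ γ.length = 2 * n ∧
            (∀ i ≤ n, γ.getVert i = M.groupGen s ^ (n - i)) ∧
            (∀ i ≤ n, γ.getVert (n + i) = M.groupGen t ^ i) ∧
            ∀ v ∈ γ.support, v ∈ M.positiveElements) ∧
          (∃ γ' : M.cayleyGraph.Walk (M.groupGen s ^ n) (M.groupGen t ^ n),
            γ'.IsGeodesic ∧ γ'.length = 2 * n ∧
            (∀ i ≤ n, γ'.getVert i =
              M.groupGen s ^ n * ((M.groupGen s * M.groupGen u) ^ i)⁻¹) ∧
            γ'.getVert n = (M.groupGen u ^ n)⁻¹ ∧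
            (∀ i ≤ n, γ'.getVert (n + i) =
              (M.groupGen u ^ n)⁻¹ * (M.groupGen t * M.groupGen u) ^ i)) ∧
          (∀ v ∈ M.positiveElements,
            (n : ℕ∞) ≤ M.cayleyGraph.edist (M.groupGen u ^ n)⁻¹ v)) ∧
    (∀ n : ℕ, 4 ≤ n →
      (∃ s t u : Fin n, s ≠ t ∧ CoxeterMatrix.A n s u = 2 ∧ CoxeterMatrix.A n t u = 2) ∧
      ¬ IsQuasiConvex (CoxeterMatrix.A n).monoidCayleyGraph) := by
  refine ⟨fun {S} _ M s t u hst hsu htu =>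
    ⟨CoxeterMatrix.not_isQuasiConvex_monoidCayleyGraph hst hsu htu, fun n => ⟨?_, ?_,
      fun v hv => M.natCast_le_edist_positiveElements u n hv⟩⟩, fun n hn => ?_⟩
  · obtain ⟨γ, hg, hl, h1, h2⟩ := CoxeterMatrix.exists_geodesic_walk (x := 1)
      (M.mem_minimalElements_of_commuting hsu).1 (M.mem_minimalElements_of_commuting htu).1
      (fun i => by rw [one_mul]; exact (CoxeterMatrix.crossing_sub_pow hst i).1)
      (fun i => by rw [one_mul]; exact (CoxeterMatrix.crossing_sub_pow hst i).2)
      (M.isShort_crossing_sub (M.simple t) (M.simple s)) n (one_mul _).symm (one_mul _).symm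
    simp only [one_mul] at h1 h2
    refine ⟨γ, hg, hl, h1, h2, fun v hv => ?_⟩
    obtain ⟨i, rfl, hi⟩ := SimpleGraph.Walk.mem_support_iff_exists_getVert.1 hv
    rcases le_total i n with hin | hin
    · rw [h1 i hin]
      exact M.groupGen_pow_mem_positiveElements s _
    · obtain ⟨k, rfl⟩ := Nat.exists_eq_add_of_le hin
      rw [h2 k (by omega)]
      exact M.groupGen_pow_mem_positiveElements t _
  · have hpow {a : S} (ha : M a u = 2) : M.groupGen a ^ n =
        (M.groupGen u ^ n)⁻¹ * (M.groupGen a * M.groupGen u) ^ n := by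
      rw [(CoxeterMatrix.commute_groupGen ha).mul_pow,
        ((CoxeterMatrix.commute_groupGen ha).pow_pow n n).eq, inv_mul_cancel_left]
    obtain ⟨γ, hg, hl, h1, h2⟩ := CoxeterMatrix.exists_geodesic_walk (x := (M.groupGen u ^ n)⁻¹)
      (M.mem_minimalElements_of_commuting hsu).2.2 (M.mem_minimalElements_of_commuting htu).2.2
      (fun i => (CoxeterMatrix.crossing_sub_inv_pow_mul_pow hst hsu htu n i).1)
      (fun i => (CoxeterMatrix.crossing_sub_inv_pow_mul_pow hst hsu htu n i).2)
      (M.isShort_crossing_sub (M.simple t) (M.simple s)) n (hpow hsu) (hpow htu)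
    refine ⟨γ, hg, hl, fun i hi => ?_, by simpa using h2 0 (Nat.zero_le n), h2⟩
    rw [h1 i hi, hpow hsu, mul_assoc, pow_sub _ hi]
  · have hA : (CoxeterMatrix.A n) ⟨0, by omega⟩ ⟨3, by omega⟩ = 2 ∧
        (CoxeterMatrix.A n) ⟨1, by omega⟩ ⟨3, by omega⟩ = 2 := by
      simp [CoxeterMatrix.A]
    have hne : (⟨0, by omega⟩ : Fin n) ≠ ⟨1, by omega⟩ := by simp
    exact ⟨⟨_, _, _, hne, hA⟩, CoxeterMatrix.not_isQuasiConvex_monoidCayleyGraph hne hA.1 hA.2⟩
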